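/- Let $(\boldsymbol{x},y,s)$ be random with values in $\mathbb{R}^d\times\{+1,-1\}\times\{+1,-1\}$ and joint law $p(\boldsymbol{x},y,s)$ satisfying $p(s=+1\mid \boldsymbol{x},y=+1)=1$. Write $p(\boldsymbol{x})$ for the marginal law of $\boldsymbol{x}$, $\pi=p(y=+1)$, $\rho=p(y=-1,s=+1)$, $p_{\mathrm P}=p(\boldsymbol{x}\mid y=+1)$, $p_{\mathrm{bN}}=p(\boldsymbol{x}\mid y=-1,s=+1)$ (with $\pi,\rho>0$) and $\sigma(\boldsymbol{x})=p(s=+1\mid\boldsymbol{x})$. Let $\ell:\mathbb{R}\to[0,\infty)$ be a loss and $R(g)=\mathbb{E}[\ell(y\,g(\boldsymbol{x}))]$. Let $\mathcal{G}$ be a class of measurable functions $\mathbb{R}^d\to\mathbb{R}$ that is pointwise measurable, i.e. it has a countable subset $\mathcal G_0$ such that every $g\in\mathcal{G}$ is the pointwise limit of a sequence in $\mathcal G_0$. Suppose that $C_g>0$, $C_\ell>0$, $L_\ell\ge 0$ are such that $|g(\boldsymbol{x})|\le C_g$ for all $g\in\mathcal{G}$ and all $\boldsymbol{x}$, $\ell(z)\le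 C_\ell$ for $|z|\le C_g$, and $\ell$ is $L_\ell$-Lipschitz on $[-C_g,C_g]$. Let $\hat\sigma:\mathbb{R}^d\to[0,1]$ be a fixed (non-random) measurable function, let $\eta\in(0,1]$, and let $(\boldsymbol{x}^{\mathrm P}_i)_{i\le n_{\mathrm P}}$, $(\boldsymbol{x}^{\mathrm{bN}}_i)_{i\le n_{\mathrm{bN}}}$, $(\boldsymbol{x}^{\mathrm U}_i)_{i\le n_{\mathrm U}}$ be i.i.d. samples from $p_{\mathrm P}$, $p_{\mathrm{bN}}$ and $p$, with $n_{\mathrm P},n_{\mathrm{bN}},n_{\mathrm U}\ge 1$. Put $w(\boldsymbol{x})=\mathbf 1_{\hat\sigma(\boldsymbol{x})>\eta}\,\frac{1-\hat\sigma(\boldsymbol{x})}{\hat\sigma(\boldsymbol{x})}$ and $$\hat R(g)=\frac{\pi}{n_{\mathrm P}}\sum_{i=1}^{n_{\mathrm P}}\Big[\ell(g(\boldsymbol{x}^{\mathrm P}_i))+w(\boldsymbol{x}^{\mathrm P}_i)\,\ell(-g(\boldsymbol{x}^{\mathrm P}_i))\Big]+\frac{\rho}{n_{\mathrm{bN}}}\sum_{i=1}^{n_{\mathrm{bN}}}\big(1+w(\boldsymbol{x}^{\mathrm{bN}}_i)\big)\ell(-g(\boldsymbol{x}^{\mathrm{bN}}_i))+\frac1{n_{\mathrm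 U}}\sum_{i=1}^{n_{\mathrm U}}\mathbf 1_{\hat\sigma(\boldsymbol{x}^{\mathrm U}_i)\le\eta}\,\ell(-g(\boldsymbol{x}^{\mathrm U}_i))\,(1-\hat\sigma(\boldsymbol{x}^{\mathrm U}_i)).$$ Let $g^*\in\mathcal{G}$ minimize $R$ over $\mathcal{G}$, and let $\hat g\in\mathcal{G}$ (depending on the samples) almost surely minimize $\hat R$ over $\mathcal{G}$. Let $\zeta=p(\hat\sigma(\boldsymbol{x})\le\eta)$ and $\epsilon=\mathbb{E}_{\boldsymbol{x}\sim p}\big[|\hat\sigma(\boldsymbol{x})-\sigma(\boldsymbol{x})|^2\big]$, and for a probability law $q$ on $\mathbb{R}^d$ let $$\mathfrak{R}_{n,q}(\mathcal{G})=\mathbb{E}_{(\boldsymbol{x}_1,\dots,\boldsymbol{x}_n)\sim q^n}\,\mathbb{E}_{\xi}\Big[\sup_{g\in\mathcal{G}}\frac1n\sum_{i=1}^n\xi_i\,g(\boldsymbol{x}_i)\Big],$$ where $\xi$ is uniformly distributed on $\{+1,-1\}^n$. Then for every $\delta>0$, with probability at least $1-\delta$, $$\begin{aligned}R(\hat g)-R(g^*)\le{}&4L_\ell\,\mathfrak{R}_{n_{\mathrm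 U},p}(\mathcal{G})+\frac{4\pi L_\ell}{\eta}\,\mathfrak{R}_{n_{\mathrm P},p_{\mathrm P}}(\mathcal{G})+\frac{4\rho L_\ell}{\eta}\,\mathfrak{R}_{n_{\mathrm{bN}},p_{\mathrm{bN}}}(\mathcal{G})\\&+2C_\ell\sqrt{\frac{\ln(6/\delta)}{2n_{\mathrm U}}}+\frac{2\pi C_\ell}{\eta}\sqrt{\frac{\ln(6/\delta)}{2n_{\mathrm P}}}+\frac{2\rho C_\ell}{\eta}\sqrt{\frac{\ln(6/\delta)}{2n_{\mathrm{bN}}}}\\&+2C_\ell\sqrt{\zeta\epsilon}+\frac{2C_\ell}{\eta}\sqrt{(1-\zeta)\epsilon}.\end{aligned}$$ (For $\delta\ge 1$ the assertion is empty.) -/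

import Mathlib

open MeasureTheory ProbabilityTheory Filter Topology
open scoped NNReal

noncomputable section

namespace PUbN

variable {X : Type*} [MeasurableSpace X]

/-- A label in `{+1, -1}` is encoded by a Boolean: `true` is `+1` and `false` is `-1`. -/
def sgn (b : Bool) : ℝ := if b then 1 else -1

/-- A joint distribution of `(x, y, s)` satisfies the PUbN constraint `p(s = +1 ∣ x, y = +1) = 1`
when the event `y = +1, s = -1` is null. -/
def PosLabeled (P : Measure (X × Bool × Bool)) : Prop :=
  P {z | z.2.1 = true ∧ z.2.2 = false} = 0

/-- The marginal distribution `p(x)`. -/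
def marginal (P : Measure (X × Bool × Bool)) : Measure X := P.map Prod.fst

/-- The class prior `π = p(y = +1)`. -/
def posPrior (P : Measure (X × Bool × Bool)) : ℝ := P.real {z | z.2.1 = true}

/-- The prior `ρ = p(y = -1, s = +1)`. -/
def bnPrior (P : Measure (X × Bool × Bool)) : ℝ := P.real {z | z.2.1 = false ∧ z.2.2 = true}

/-- The conditional distribution `p_P(x) = p(x ∣ y = +1)`. -/
def posLaw (P : Measure (X × Bool × Bool)) : Measure X :=
  (ProbabilityTheory.cond P {z | z.2.1 = true}).map Prod.fst

/-- The conditional distribution `p_bN(x) = p(x ∣ y = -1, s = +1)`. -/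
def bnLaw (P : Measure (X × Bool × Bool)) : Measure X :=
  (ProbabilityTheory.cond P {z | z.2.1 = false ∧ z.2.2 = true}).map Prod.fst

/-- The conditional probability `σ(x) = p(s = +1 ∣ x) = p(x, s = +1) / p(x)`, as the
Radon-Nikodym derivative of `p(x, s = +1)` with respect to `p(x)`. -/
def sigma (P : Measure (X × Bool × Bool)) (x : X) : ℝ :=
  (((P.restrict {z | z.2.2 = true}).map Prod.fst).rnDeriv (marginal P) x).toReal

/-- The classification risk `R(g) = E[ℓ(y g(x))]`. -/
def risk (P : Measure (X × Bool × Bool)) (ℓ : ℝ → ℝ) (g : X → ℝ) : ℝ :=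
  ∫ z, ℓ (sgn z.2.1 * g z.1) ∂P

/-- The average `(1/n) ∑ i, f (x i)` over a sample. -/
def avg {n : ℕ} (x : Fin n → X) (f : X → ℝ) : ℝ := (1 / (n : ℝ)) * ∑ i, f (x i)

/-- The contribution `1_{σ̂(x) ≤ η} ℓ(-g(x)) (1 - σ̂(x))` of an unlabeled point. -/
def uTerm (ℓ : ℝ → ℝ) (σhat : X → ℝ) (η : ℝ) (g : X → ℝ) : X → ℝ :=
  Set.indicator {x | σhat x ≤ η} fun x => ℓ (-g x) * (1 - σhat x)

/-- The contribution `1_{σ̂(x) > η} ℓ(-g(x)) (1 - σ̂(x)) / σ̂(x)` of a labeled point to the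
estimate of the risk on `s = -1`. -/
def labTerm (ℓ : ℝ → ℝ) (σhat : X → ℝ) (η : ℝ) (g : X → ℝ) : X → ℝ :=
  Set.indicator {x | η < σhat x} fun x => ℓ (-g x) * ((1 - σhat x) / σhat x)

/-- The PUbN empirical risk with weights `π`, `ρ` computed from the samples `xP`, `xbN`, `xU`. -/
def empRisk (π ρ : ℝ) (ℓ : ℝ → ℝ) (σhat : X → ℝ) (η : ℝ) {nP nbN nU : ℕ}
    (xP : Fin nP → X) (xbN : Fin nbN → X) (xU : Fin nU → X) (g : X → ℝ) : ℝ :=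
  π * avg xP (fun x => ℓ (g x)) + ρ * avg xbN (fun x => ℓ (-g x))
    + (avg xU (uTerm ℓ σhat η g) + π * avg xP (labTerm ℓ σhat η g)
      + ρ * avg xbN (labTerm ℓ σhat η g))

/-- The Rademacher complexity of `G` for samples of size `n` from `q`:
`E_{x ∼ qⁿ} E_ξ [sup_{g ∈ G} (1/n) ∑ i, ξ i * g (x i)]`, with `ξ` uniform on `{+1, -1}ⁿ`. -/
def rademacher (n : ℕ) (q : Measure X) (G : Set (X → ℝ)) : ℝ :=
  ∫ x : Fin n → X,
    (1 / 2 ^ n : ℝ) * ∑ ξ : Fin n → Bool,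
      ⨆ g : G, (1 / (n : ℝ)) * ∑ i, sgn (ξ i) * (g : X → ℝ) (x i)
    ∂(Measure.pi fun _ => q)

/-- `G` is a pointwise measurable class: it consists of measurable functions and has a countable
subset of which every member of `G` is a pointwise limit of a sequence. This is the usual
condition that makes the suprema over `G` measurable. -/
def PointwiseMeasurable (G : Set (X → ℝ)) : Prop :=
  (∀ g ∈ G, Measurable g) ∧
    ∃ G₀ ⊆ G, G₀.Countable ∧ ∀ g ∈ G, ∃ u : ℕ → X → ℝ,
      (∀ k, u k ∈ G₀) ∧ ∀ x, Tendsto (fun k => u k x) atTop (𝓝 (g x))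

/-- The random points `x i` form an i.i.d. sample from `q`. -/
def IsSample {Ω : Type*} [MeasurableSpace Ω] (μ : Measure Ω) {n : ℕ} (q : Measure X)
    (x : Fin n → Ω → X) : Prop :=
  iIndepFun x μ ∧ ∀ i, HasLaw (x i) q μ

end PUbN

end

/-!
The proof is the usual comparison of an empirical risk minimizer with a risk minimizer, through the
population counterpart `R̄` of the empirical risk `R̂`:
`R(ĝ) - R(g*) ≤ 2 sup_g |R(g) - R̄(g)| + 2 sup_g |R̂(g) - R̄(g)|`.

*Bias.* The risk is `π E_P[ℓ(g)] + ρ E_bN[ℓ(-g)] + E_p[(1 - σ) ℓ(-g)]`, and `R̄` differs from it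
only in the last term. Since `π p_P + ρ p_bN = σ p`, the weighted labeled points of `R̄` contribute
`E_p[1_{σ̂ > η} σ (1 - σ̂) / σ̂ · ℓ(-g)]`, and the two integrands differ by
`1_{σ̂ ≤ η} (σ̂ - σ) ℓ(-g) + 1_{σ̂ > η} (σ̂ - σ) / σ̂ · ℓ(-g)`. Cauchy–Schwarz on `σ̂ ≤ η` and on
`σ̂ > η` gives the terms in `ζ ε` and `(1 - ζ) ε` (`abs_risk_sub_le`).

*Estimation.* For each of the three samples `R̂` contains one average of a class of functions
`x ↦ F x (g x)` with `F x` Lipschitz. As `1 + w ≤ 1 / η`, the range and the Lipschitz constant are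
`Cℓ / η` and `Lℓ / η` for the labeled samples, and `Cℓ` and `Lℓ` for the unlabeled one. The largest
deviation of such averages from their means concentrates around its expectation by the bounded
differences inequality (`hasSubgaussianMGF_of_boundedDifferences`). The expectation is at most twice
the Rademacher complexity of the class, by symmetrization (`integral_supDev_le`), which is at most
the Lipschitz constant times that of `G`, by contraction (`empRademacher_le_of_lipschitz`). Two
one-sided bounds for each of three samples, each failing with probability at most `δ / 6`, yield the
factor `log (6 / δ)`.
-/

open MeasureTheory ProbabilityTheory Filter Topology
open scoped NNReal

noncomputable section

namespace PUbN

variable {X : Type*}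

/-! ### Rademacher averages -/

/-- The empirical Rademacher complexity `E_ξ [sup_i (1/n) ∑ j, ξ j * f i (x j)]` at the points
`x` of a class given as an indexed family. -/
def empRademacher {ι : Type*} {n : ℕ} (f : ι → X → ℝ) (x : Fin n → X) : ℝ :=
  (1 / 2 ^ n : ℝ) * ∑ ξ : Fin n → Bool, ⨆ i, (1 / (n : ℝ)) * ∑ j, sgn (ξ j) * f i (x j)

lemma abs_sgn (b : Bool) : |sgn b| = 1 := by cases b <;> simp [sgn]

lemma abs_sum_sgn_mul_le {n : ℕ} {M : ℝ} (ξ : Fin n → Bool) {a : Fin n → ℝ} (ha : ∀ j, |a j| ≤ M) :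
    |∑ j, sgn (ξ j) * a j| ≤ n * M := by
  refine (Finset.abs_sum_le_sum_abs _ _).trans ?_
  refine (Finset.sum_le_card_nsmul _ _ M fun j _ => ?_).trans (by simp)
  rw [abs_mul, abs_sgn, one_mul]
  exact ha j

lemma abs_mean_sgn_mul_le {n : ℕ} {M : ℝ} (hM : 0 ≤ M) (ξ : Fin n → Bool) {a : Fin n → ℝ}
    (ha : ∀ j, |a j| ≤ M) : |(1 / (n : ℝ)) * ∑ j, sgn (ξ j) * a j| ≤ M := by
  rw [abs_mul, abs_of_nonneg (by positivity : (0 : ℝ) ≤ 1 / n), one_div]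
  rcases Nat.eq_zero_or_pos n with rfl | hn
  · simpa using hM
  have hn' : (0 : ℝ) < n := by exact_mod_cast hn
  rw [inv_mul_le_iff₀ hn']
  exact abs_sum_sgn_mul_le ξ ha

lemma bddAbove_range_of_abs_le {ι : Type*} {a : ι → ℝ} {M : ℝ} (h : ∀ i, |a i| ≤ M) :
    BddAbove (Set.range a) :=
  ⟨M, by rintro _ ⟨i, rfl⟩; exact (abs_le.1 (h i)).2⟩

lemma abs_iSup_le {ι : Type*} [Nonempty ι] {a : ι → ℝ} {M : ℝ} (h : ∀ i, |a i| ≤ M) :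
    |⨆ i, a i| ≤ M := by
  refine abs_le.2 ⟨?_, ciSup_le fun i => (abs_le.1 (h i)).2⟩
  obtain ⟨i⟩ := ‹Nonempty ι›
  exact (abs_le.1 (h i)).1.trans (le_ciSup (bddAbove_range_of_abs_le h) i)

/-! ### The contraction principle -/

/-- The contraction principle for a single Rademacher sign. -/
lemma iSup_add_iSup_sub_le {ι : Type*} [Nonempty ι] {v b c : ι → ℝ} {M : ℝ}
    (hv : ∀ i, |v i| ≤ M) (hc : ∀ i, |c i| ≤ M)
    (hbc : ∀ i j, |b i - b j| ≤ |c i - c j|) :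
    (⨆ i, (v i + b i)) + (⨆ i, (v i - b i)) ≤ (⨆ i, (v i + c i)) + ⨆ i, (v i - c i) := by
  have h1 : BddAbove (Set.range fun i => v i + c i) :=
    bddAbove_range_of_abs_le (M := M + M) fun i => (abs_add_le _ _).trans (add_le_add (hv i) (hc i))
  have h2 : BddAbove (Set.range fun i => v i - c i) :=
    bddAbove_range_of_abs_le (M := M + M) fun i => (abs_sub _ _).trans (add_le_add (hv i) (hc i))
  rw [← le_sub_iff_add_le]
  refine ciSup_le fun i => ?_
  rw [le_sub_comm]
  refine ciSup_le fun j => ?_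
  have hi := le_ciSup h1 i
  have hj := le_ciSup h1 j
  have hi' := le_ciSup h2 i
  have hj' := le_ciSup h2 j
  have := (le_abs_self _).trans (hbc i j)
  rcases abs_cases (c i - c j) with h | h <;> linarith

lemma sum_fin_succ_bool {n : ℕ} (F : (Fin (n + 1) → Bool) → ℝ) :
    ∑ ξ, F ξ = ∑ ξ : Fin n → Bool, (F (Fin.cons true ξ) + F (Fin.cons false ξ)) := by
  rw [← (Fin.consEquiv fun _ => Bool).sum_comp, Fintype.sum_prod_type, Fintype.sum_bool,
    Finset.sum_add_distrib]
  rfl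

/-- The Ledoux–Talagrand contraction principle, without absolute values. The offset `u` is what
makes the induction on the number of signs work. -/
lemma sum_iSup_contraction {ι : Type*} [Nonempty ι] {M : ℝ} : ∀ {n : ℕ} {b c : Fin n → ι → ℝ}
    {u : ι → ℝ} {M' : ℝ}, (∀ i, |u i| ≤ M') → (∀ j i, |b j i| ≤ M) → (∀ j i, |c j i| ≤ M) →
    (∀ j i i', |b j i - b j i'| ≤ |c j i - c j i'|) →
    ∑ ξ : Fin n → Bool, ⨆ i, (u i + ∑ j, sgn (ξ j) * b j i) ≤
      ∑ ξ : Fin n → Bool, ⨆ i, (u i + ∑ j, sgn (ξ j) * c j i) := by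
  intro n
  induction n with
  | zero => intros; simp
  | succ n ih =>
    intro b c u M' hu hb hc hbc
    have key : ∀ s : Bool,
        ∑ ξ : Fin n → Bool, ⨆ i, (u i + (sgn s * b 0 i + ∑ j, sgn (ξ j) * b j.succ i)) ≤
        ∑ ξ : Fin n → Bool, ⨆ i, ((u i + sgn s * b 0 i) + ∑ j, sgn (ξ j) * c j.succ i) := by
      intro s
      simp_rw [← add_assoc]
      refine ih (M' := M' + M) (fun i => ?_) (fun j i => hb _ i) (fun j i => hc _ i)
        (fun j i i' => hbc _ i i')
      refine (abs_add_le _ _).trans (add_le_add (hu i) ?_)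
      rw [abs_mul, abs_sgn, one_mul]
      exact hb 0 i
    simp only [sum_fin_succ_bool, Fin.sum_univ_succ, Fin.cons_zero, Fin.cons_succ]
    rw [Finset.sum_add_distrib]
    refine (add_le_add (key true) (key false)).trans ?_
    rw [← Finset.sum_add_distrib]
    refine Finset.sum_le_sum fun ξ _ => ?_
    have h := iSup_add_iSup_sub_le (v := fun i => u i + ∑ j, sgn (ξ j) * c j.succ i) (b := b 0)
      (c := c 0) (M := max (M' + n * M) M)
      (fun i => le_max_of_le_left ((abs_add_le _ _).trans
        (add_le_add (hu i) (abs_sum_sgn_mul_le ξ fun j => hc _ i))))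
      (fun i => le_max_of_le_right (hc 0 i)) (hbc 0)
    refine (le_of_eq ?_).trans (h.trans (le_of_eq ?_)) <;>
    · congr 1 <;> refine congrArg iSup (funext fun i => ?_) <;> simp [sgn] <;> ring

/-- A class whose members depend Lipschitz-continuously on those of another class, at every point,
has at most the correspondingly scaled Rademacher complexity. -/
lemma empRademacher_le_of_lipschitz {ι : Type*} [Nonempty ι] {n : ℕ} {f g : ι → X → ℝ}
    {M L : ℝ} (hL : 0 ≤ L) (hf : ∀ i x, |f i x| ≤ M) (hg : ∀ i x, |g i x| ≤ M)
    (hfg : ∀ i j x, |f i x - f j x| ≤ L * |g i x - g j x|) (x : Fin n → X) :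
    empRademacher f x ≤ L * empRademacher g x := by
  have h := sum_iSup_contraction (u := fun _ : ι => (0 : ℝ)) (M' := 0)
    (b := fun (j : Fin n) i => f i (x j)) (c := fun j i => L * g i (x j)) (M := max M (L * M))
    (by simp) (fun j i => le_max_of_le_left (hf _ _))
    (fun j i => le_max_of_le_right (by
      rw [abs_mul, abs_of_nonneg hL]; exact mul_le_mul_of_nonneg_left (hg _ _) hL))
    (fun j i i' => by rw [← mul_sub, abs_mul, abs_of_nonneg hL]; exact hfg _ _ _)
  simp only [zero_add] at h
  unfold empRademacher
  rw [mul_left_comm]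
  refine mul_le_mul_of_nonneg_left ?_ (by positivity)
  rw [Finset.mul_sum]
  simp_rw [Real.mul_iSup_of_nonneg hL, ← Real.mul_iSup_of_nonneg (by positivity : (0:ℝ) ≤ 1 / n),
    mul_left_comm L, ← Real.mul_iSup_of_nonneg (by positivity : (0:ℝ) ≤ 1 / n)]
  rw [← Finset.mul_sum, ← Finset.mul_sum]
  refine mul_le_mul_of_nonneg_left ?_ (by positivity)
  refine h.trans (le_of_eq ?_)
  refine Finset.sum_congr rfl fun ξ _ => congrArg iSup (funext fun i => ?_)
  rw [Finset.mul_sum]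
  exact Finset.sum_congr rfl fun _ _ => by ring

variable [MeasurableSpace X]

/-! ### The bounded differences inequality -/

lemma integrable_of_abs_le {Y : Type*} [MeasurableSpace Y] {ν : Measure Y} [IsFiniteMeasure ν]
    {f : Y → ℝ} (hf : Measurable f) {M : ℝ} (h : ∀ y, |f y| ≤ M) : Integrable f ν :=
  Integrable.of_bound hf.aestronglyMeasurable M (ae_of_all _ h)

/-- McDiarmid's inequality, as a bound on the moment generating function: a bounded measurable
function of `n` independent points which changes by at most `c` when one of them is changed is
sub-Gaussian with parameter `n (c / 2) ^ 2`. The induction on `n` applies Hoeffding's lemma to the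
first point after averaging over the others. -/
lemma hasSubgaussianMGF_of_boundedDifferences (q : Measure X) [IsProbabilityMeasure q] (c : ℝ≥0)
    {M : ℝ} : ∀ {n : ℕ} {f : (Fin n → X) → ℝ}, Measurable f → (∀ x, |f x| ≤ M) →
    (∀ x j a, |f (Function.update x j a) - f x| ≤ c) →
    HasSubgaussianMGF (fun x => f x - ∫ y, f y ∂(Measure.pi fun _ => q)) (n * (c / 2) ^ 2)
      (Measure.pi fun _ => q) := by
  intro n
  induction n with
  | zero =>
    intro f hf hM hc
    have h0 : (fun x => f x - ∫ y, f y ∂(Measure.pi fun _ : Fin 0 => q)) = fun _ => 0 := by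
      funext x
      have : f = fun _ => f x := funext fun y => by rw [Subsingleton.elim y x]
      rw [this]
      simp
    rw [h0]
    simp
  | succ n ih =>
    intro f hf hM hc
    set ν := Measure.pi fun _ : Fin n => q
    -- the first point is split off, so that the law is a product of `q` and the law of the rest
    have hcons : ⇑(MeasurableEquiv.piFinSuccAbove (fun _ : Fin (n + 1) => X) 0).symm =
        fun z : X × (Fin n → X) => (Fin.cons z.1 z.2 : Fin (n + 1) → X) :=
      funext fun z => Fin.insertNth_zero' z.1 z.2
    have hmp : MeasurePreserving (fun z : X × (Fin n → X) => (Fin.cons z.1 z.2 : Fin (n + 1) → X))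
        (q.prod ν) (Measure.pi fun _ => q) := by
      have := (measurePreserving_piFinSuccAbove (fun _ : Fin (n + 1) => q) 0).symm
      rwa [hcons] at this
    have hemb : MeasurableEmbedding
        (fun z : X × (Fin n → X) => (Fin.cons z.1 z.2 : Fin (n + 1) → X)) := by
      have := (MeasurableEquiv.piFinSuccAbove (fun _ : Fin (n + 1) => X) 0).symm.measurableEmbedding
      rwa [hcons] at this
    have hF : Measurable fun z : X × (Fin n → X) => f (Fin.cons z.1 z.2) := hf.comp hmp.measurable
    have hFa : ∀ a, Measurable fun y : Fin n → X => f (Fin.cons a y) := fun a =>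
      hF.comp measurable_prodMk_left
    set h : X → ℝ := fun a => ∫ y, f (Fin.cons a y) ∂ν with hh
    have hhm : Measurable h := hF.stronglyMeasurable.integral_prod_right.measurable
    -- the mean over the other points inherits the bounded difference in the first one
    have hosc : ∀ a b, h a ≤ h b + c := by
      intro a b
      have : (∫ y, f (Fin.cons a y) ∂ν) ≤ ∫ y, (f (Fin.cons b y) + c) ∂ν := by
        refine integral_mono (integrable_of_abs_le (hFa a) fun y => hM _)
          ((integrable_of_abs_le (hFa b) fun y => hM _).add (integrable_const _)) fun y => ?_
        have := (abs_le.1 (hc (Fin.cons b y) 0 a)).2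
        rw [Fin.update_cons_zero] at this
        linarith
      rw [integral_add (integrable_of_abs_le (hFa b) fun y => hM _) (integrable_const _)] at this
      simpa using this
    have hX : Nonempty X := nonempty_of_isProbabilityMeasure q
    have hbdd : BddBelow (Set.range h) := by
      obtain ⟨b⟩ := hX
      exact ⟨h b - c, by rintro _ ⟨a, rfl⟩; linarith [hosc b a]⟩
    have hIcc : ∀ a, h a ∈ Set.Icc (⨅ b, h b) ((⨅ b, h b) + c) := fun a =>
      ⟨ciInf_le hbdd a, sub_le_iff_le_add.1 (le_ciInf fun b => by linarith [hosc a b])⟩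
    have hmean : ∫ x, f x ∂(Measure.pi fun _ : Fin (n + 1) => q) = ∫ a, h a ∂q := by
      rw [← hmp.integral_comp hemb, integral_prod _ (integrable_of_abs_le hF fun z => hM _)]
    rw [hmean]
    set m := ∫ a, h a ∂q with hm
    have hsub : HasSubgaussianMGF (fun a => h a - m) ((c / 2) ^ 2) q := by
      have := hasSubgaussianMGF_of_mem_Icc (μ := q) hhm.aemeasurable (ae_of_all _ hIcc)
      simpa using this
    have hih : ∀ a, HasSubgaussianMGF (fun y => f (Fin.cons a y) - h a) (n * (c / 2) ^ 2) ν := by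
      intro a
      refine ih (hFa a) (fun y => hM _) fun y j b => ?_
      have := hc (Fin.cons a y) j.succ b
      rwa [← Fin.cons_update] at this
    have hint : ∀ t : ℝ, Integrable (fun x => Real.exp (t * (f x - m)))
        (Measure.pi fun _ : Fin (n + 1) => q) := fun t =>
      integrable_exp_mul_of_mem_Icc (a := -M - m) (b := M - m) (hf.sub_const _).aemeasurable
        (ae_of_all _ fun x =>
          ⟨by linarith [(abs_le.1 (hM x)).1], by linarith [(abs_le.1 (hM x)).2]⟩)
    refine ⟨hint, fun t => ?_⟩
    have hint' : Integrable (fun z : X × (Fin n → X) =>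
        Real.exp (t * (f (Fin.cons z.1 z.2) - m))) (q.prod ν) :=
      hmp.integrable_comp_of_integrable (hint t)
    have hstep : ∀ a, ∫ y, Real.exp (t * (f (Fin.cons a y) - m)) ∂ν ≤
        Real.exp (t * (h a - m)) * Real.exp (((n * (c / 2) ^ 2 : ℝ≥0) : ℝ) * t ^ 2 / 2) := by
      intro a
      have : ∀ y, Real.exp (t * (f (Fin.cons a y) - m)) =
          Real.exp (t * (h a - m)) * Real.exp (t * (f (Fin.cons a y) - h a)) := by
        intro y; rw [← Real.exp_add]; congr 1; ring
      simp_rw [this]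
      rw [integral_const_mul]
      exact mul_le_mul_of_nonneg_left ((hih a).mgf_le t) (Real.exp_pos _).le
    calc mgf (fun x => f x - m) (Measure.pi fun _ => q) t
        = ∫ a, ∫ y, Real.exp (t * (f (Fin.cons a y) - m)) ∂ν ∂q := by
          rw [mgf, ← hmp.integral_comp hemb, integral_prod _ hint']
      _ ≤ ∫ a, Real.exp (t * (h a - m)) *
            Real.exp (((n * (c / 2) ^ 2 : ℝ≥0) : ℝ) * t ^ 2 / 2) ∂q :=
          integral_mono hint'.integral_prod_left ((hsub.integrable_exp_mul t).mul_const _) hstep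
      _ ≤ Real.exp (((c / 2 : ℝ≥0) ^ 2 : ℝ≥0) * t ^ 2 / 2) *
            Real.exp (((n * (c / 2) ^ 2 : ℝ≥0) : ℝ) * t ^ 2 / 2) := by
          rw [integral_mul_const]
          exact mul_le_mul_of_nonneg_right (hsub.mgf_le t) (Real.exp_pos _).le
      _ = _ := by
          rw [← Real.exp_add]
          congr 1
          push_cast
          ring

/-! ### Symmetrization -/

/-- The largest deviation `sup_i (avg x (f i) - E_q[f i])` of the sample averages of a class from
their means. -/
def supDev {ι : Type*} {n : ℕ} (q : Measure X) (f : ι → X → ℝ) (x : Fin n → X) : ℝ :=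
  ⨆ i, (avg x (f i) - ∫ y, f i y ∂q)

lemma abs_avg_le {Y : Type*} {n : ℕ} {M : ℝ} (hM : 0 ≤ M) {f : Y → ℝ} (hf : ∀ y, |f y| ≤ M)
    (x : Fin n → Y) :
    |avg x f| ≤ M := by
  simpa [avg, sgn] using abs_mean_sgn_mul_le hM (fun _ : Fin n => true) fun j => hf (x j)

lemma measurable_avg {n : ℕ} {f : X → ℝ} (hf : Measurable f) :
    Measurable fun x : Fin n → X => avg x f := by
  unfold avg
  fun_prop

lemma abs_integral_le_of_abs_le {Y : Type*} [MeasurableSpace Y] (ν : Measure Y)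
    [IsProbabilityMeasure ν] {f : Y → ℝ} {M : ℝ} (hf : ∀ y, |f y| ≤ M) : |∫ y, f y ∂ν| ≤ M := by
  simpa using norm_integral_le_of_norm_le_const (μ := ν) (f := f) (ae_of_all _ hf)

lemma integral_avg (q : Measure X) [IsProbabilityMeasure q] {n : ℕ} (hn : 0 < n) {f : X → ℝ}
    (hf : Measurable f) {M : ℝ} (hM : ∀ y, |f y| ≤ M) :
    ∫ x : Fin n → X, avg x f ∂(Measure.pi fun _ => q) = ∫ y, f y ∂q := by
  unfold avg
  have hj : ∀ j : Fin n, ∫ x : Fin n → X, f (x j) ∂(Measure.pi fun _ => q) = ∫ y, f y ∂q :=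
    fun j => by
      have hmp := measurePreserving_eval (fun _ : Fin n => q) j
      exact (integral_map hmp.measurable.aemeasurable
        (hmp.map_eq.symm ▸ hf.aestronglyMeasurable)).symm.trans (by rw [hmp.map_eq])
  rw [integral_const_mul, integral_finsetSum]
  · simp_rw [hj]
    have : (n : ℝ) ≠ 0 := by exact_mod_cast hn.ne'
    simp
    field_simp
  · exact fun j _ => integrable_of_abs_le (hf.comp (measurable_pi_apply j)) fun x => hM _

variable {ι : Type*}

lemma abs_avg_sub_integral_le (q : Measure X) [IsProbabilityMeasure q] {n : ℕ} {M : ℝ}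
    (hM : 0 ≤ M) {f : X → ℝ} (hf : ∀ y, |f y| ≤ M) (x : Fin n → X) :
    |avg x f - ∫ y, f y ∂q| ≤ M + M :=
  (abs_sub _ _).trans (add_le_add (abs_avg_le hM hf x) (abs_integral_le_of_abs_le q hf))

lemma abs_supDev_le [Nonempty ι] (q : Measure X) [IsProbabilityMeasure q] {n : ℕ} {M : ℝ}
    (hM : 0 ≤ M) {f : ι → X → ℝ} (hf : ∀ i y, |f i y| ≤ M) (x : Fin n → X) :
    |supDev q f x| ≤ M + M :=
  abs_iSup_le fun i => abs_avg_sub_integral_le q hM (hf i) x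

/-- Exchanging the coordinates that `ξ` selects between a sample and an independent copy of it
preserves the joint law. -/
lemma measurePreserving_exchange (q : Measure X) [IsProbabilityMeasure q] {n : ℕ}
    (ξ : Fin n → Bool) :
    MeasurePreserving (fun z : (Fin n → X) × (Fin n → X) =>
      ((fun j => if ξ j then z.1 j else z.2 j), fun j => if ξ j then z.2 j else z.1 j))
      ((Measure.pi fun _ => q).prod (Measure.pi fun _ => q))
      ((Measure.pi fun _ => q).prod (Measure.pi fun _ => q)) := by
  have h1 := measurePreserving_arrowProdEquivProdArrow X X (Fin n) (fun _ => q) (fun _ => q)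
  have h2 : MeasurePreserving
      (fun (w : Fin n → X × X) j => (if ξ j then id else Prod.swap : X × X → X × X) (w j))
      (Measure.pi fun _ => q.prod q) (Measure.pi fun _ => q.prod q) := by
    refine measurePreserving_pi (fun _ : Fin n => q.prod q) (fun _ : Fin n => q.prod q)
      (f := fun j => (if ξ j then id else Prod.swap : X × X → X × X)) fun j => ?_
    cases ξ j
    · simpa using Measure.measurePreserving_swap
    · simpa using MeasurePreserving.id _
  have h3 := h1.comp (h2.comp h1.symm)
  convert h3 using 1
  funext z
  refine Prod.ext (funext fun j => ?_) (funext fun j => ?_) <;>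
  · by_cases h : ξ j <;>
      simp [h, MeasurableEquiv.arrowProdEquivProdArrow, Equiv.arrowProdEquivProdArrow]

lemma measurable_supDev [Countable ι] (q : Measure X) {n : ℕ} {f : ι → X → ℝ}
    (hf : ∀ i, Measurable (f i)) : Measurable fun x : Fin n → X => supDev q f x :=
  Measurable.iSup fun i => (measurable_avg (hf i)).sub_const _

lemma measurable_iSup_mean [Countable ι] {n : ℕ} {f : ι → X → ℝ} (hf : ∀ i, Measurable (f i))
    (ξ : Fin n → Bool) :
    Measurable fun x : Fin n → X => ⨆ i, (1 / (n : ℝ)) * ∑ j, sgn (ξ j) * f i (x j) :=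
  Measurable.iSup fun i => by
    have := hf i
    fun_prop

lemma integrable_empRademacher [Nonempty ι] [Countable ι] (q : Measure X) [IsProbabilityMeasure q]
    {n : ℕ} {f : ι → X → ℝ} (hf : ∀ i, Measurable (f i)) {M : ℝ} (hM : 0 ≤ M)
    (hfM : ∀ i y, |f i y| ≤ M) :
    Integrable (fun x : Fin n → X => empRademacher f x) (Measure.pi fun _ => q) :=
  (integrable_finsetSum _ fun ξ _ => integrable_of_abs_le (measurable_iSup_mean hf ξ) fun x =>
    abs_iSup_le fun i => abs_mean_sgn_mul_le hM ξ fun j => hfM i (x j)).const_mul _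

/-- Symmetrization: the expected largest deviation is at most twice the Rademacher complexity. -/
lemma integral_supDev_le [Nonempty ι] [Countable ι] (q : Measure X) [IsProbabilityMeasure q] {n : ℕ}
    (hn : 0 < n) {f : ι → X → ℝ} (hf : ∀ i, Measurable (f i)) {M : ℝ} (hM : 0 ≤ M)
    (hfM : ∀ i y, |f i y| ≤ M) :
    ∫ x : Fin n → X, supDev q f x ∂(Measure.pi fun _ => q) ≤
      2 * ∫ x : Fin n → X, empRademacher f x ∂(Measure.pi fun _ => q) := by
  set ν := Measure.pi fun _ : Fin n => q
  -- the expected value of the supremum for a fixed choice of signs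
  set A : (Fin n → Bool) → ℝ := fun ξ =>
    ∫ x : Fin n → X, ⨆ i, (1 / (n : ℝ)) * ∑ j, sgn (ξ j) * f i (x j) ∂ν with hA
  have hSmean : ∀ (ξ : Fin n → Bool) i (x : Fin n → X),
      |(1 / (n : ℝ)) * ∑ j, sgn (ξ j) * f i (x j)| ≤ M := fun ξ i x =>
    abs_mean_sgn_mul_le hM ξ fun j => hfM i (x j)
  have hSint : ∀ ξ : Fin n → Bool, Integrable
      (fun x : Fin n → X => ⨆ i, (1 / (n : ℝ)) * ∑ j, sgn (ξ j) * f i (x j)) ν := fun ξ =>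
    integrable_of_abs_le (measurable_iSup_mean hf ξ) fun x => abs_iSup_le fun i => hSmean ξ i x
  set D : (Fin n → X) × (Fin n → X) → ℝ := fun z => ⨆ i, (avg z.1 (f i) - avg z.2 (f i)) with hD
  have hDle : ∀ i (z : (Fin n → X) × (Fin n → X)), |avg z.1 (f i) - avg z.2 (f i)| ≤ M + M :=
    fun i z => (abs_sub _ _).trans
      (add_le_add (abs_avg_le hM (hfM i) _) (abs_avg_le hM (hfM i) _))
  have hDm : Measurable D := Measurable.iSup fun i =>
    ((measurable_avg (hf i)).comp measurable_fst).sub ((measurable_avg (hf i)).comp measurable_snd)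
  have hDint : Integrable D (ν.prod ν) :=
    integrable_of_abs_le hDm fun z => abs_iSup_le fun i => hDle i z
  -- the means are replaced by averages over an independent copy of the sample
  have hghost : ∫ x, supDev q f x ∂ν ≤ ∫ z, D z ∂(ν.prod ν) := by
    rw [integral_prod _ hDint]
    refine integral_mono (integrable_of_abs_le (measurable_supDev q hf) fun x =>
      abs_supDev_le q hM hfM x) hDint.integral_prod_left fun x => ciSup_le fun i => ?_
    have h1 : avg x (f i) - ∫ y, f i y ∂q = ∫ y : Fin n → X, (avg x (f i) - avg y (f i)) ∂ν := by
      rw [integral_sub (integrable_const _)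
        (integrable_of_abs_le (measurable_avg (hf i)) fun y => abs_avg_le hM (hfM i) y),
        integral_avg q hn (hf i) (hfM i)]
      simp
    rw [h1]
    refine integral_mono (integrable_of_abs_le (measurable_const.sub (measurable_avg (hf i)))
      fun y => hDle i (x, y)) ?_ fun y => ?_
    · exact integrable_of_abs_le (hDm.comp measurable_prodMk_left) fun y =>
        abs_iSup_le fun i => hDle i (x, y)
    · exact le_ciSup (bddAbove_range_of_abs_le fun i => hDle i (x, y)) i
  -- the exchange attached to `ξ` multiplies the `j`-th difference by the sign `ξ j`
  have hsign : ∀ ξ : Fin n → Bool, ∫ z, D z ∂(ν.prod ν) ≤ A ξ + A (fun j => !ξ j) := by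
    intro ξ
    have hmp := measurePreserving_exchange q ξ
    rw [← hmp.map_eq, integral_map hmp.measurable.aemeasurable hDm.aestronglyMeasurable]
    have h1 := (hSint ξ).comp_fst ν
    have h2 := (hSint fun j => !ξ j).comp_snd ν
    have h3 : A ξ + (A fun j => !ξ j) = ∫ z : (Fin n → X) × (Fin n → X),
        ((⨆ i, (1 / (n : ℝ)) * ∑ j, sgn (ξ j) * f i (z.1 j)) +
          ⨆ i, (1 / (n : ℝ)) * ∑ j, sgn (!ξ j) * f i (z.2 j)) ∂(ν.prod ν) := by
      rw [integral_add h1 h2, integral_fun_fst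
        (f := fun x : Fin n → X => ⨆ i, (1 / (n : ℝ)) * ∑ j, sgn (ξ j) * f i (x j)),
        integral_fun_snd
        (f := fun x : Fin n → X => ⨆ i, (1 / (n : ℝ)) * ∑ j, sgn (!ξ j) * f i (x j))]
      simp [hA]
    rw [h3]
    refine integral_mono (hmp.integrable_comp_of_integrable hDint) (h1.add h2)
      fun z => ciSup_le fun i => ?_
    have e : avg (fun j => if ξ j then z.1 j else z.2 j) (f i) -
        avg (fun j => if ξ j then z.2 j else z.1 j) (f i) =
        (1 / (n : ℝ)) * ∑ j, sgn (ξ j) * f i (z.1 j) +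
          (1 / (n : ℝ)) * ∑ j, sgn (!ξ j) * f i (z.2 j) := by
      unfold avg
      rw [← mul_sub, ← mul_add, ← Finset.sum_sub_distrib, ← Finset.sum_add_distrib]
      congr 1
      refine Finset.sum_congr rfl fun j _ => ?_
      by_cases h : ξ j = true <;> simp [h, sgn] <;> ring
    exact e.le.trans (add_le_add
      (le_ciSup (bddAbove_range_of_abs_le fun i => hSmean ξ i z.1) i)
      (le_ciSup (bddAbove_range_of_abs_le fun i => hSmean (fun j => !ξ j) i z.2) i))
  have hnot : ∑ ξ : Fin n → Bool, A (fun j => !ξ j) = ∑ ξ, A ξ :=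
    (Equiv.piCongrRight fun _ : Fin n => Equiv.boolNot).sum_comp A
  have hsum : (2 : ℝ) ^ n * ∫ z, D z ∂(ν.prod ν) ≤ 2 * ∑ ξ, A ξ := by
    have := Finset.sum_le_sum fun ξ (_ : ξ ∈ Finset.univ) => hsign ξ
    rw [Finset.sum_add_distrib, hnot] at this
    simp only [Finset.sum_const, Finset.card_univ, Fintype.card_pi, Fintype.card_bool,
      Finset.prod_const, Fintype.card_fin, nsmul_eq_mul] at this
    push_cast at this
    linarith
  have hR : ∫ x : Fin n → X, empRademacher f x ∂ν = (1 / 2 ^ n) * ∑ ξ, A ξ := by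
    unfold empRademacher
    rw [integral_const_mul, integral_finsetSum _ fun ξ _ => hSint ξ]
  rw [hR]
  refine hghost.trans ?_
  have h2 : (0 : ℝ) < 2 ^ n := by positivity
  rw [mul_left_comm, one_div, le_inv_mul_iff₀ h2]
  exact hsum

/-! ### Concentration of the largest deviation -/

/-- Changing one of the `n` points changes an average of numbers in an interval of length
`K` by at most `K / n`. -/
lemma avg_update_sub_le {Y : Type*} {n : ℕ} {f : Y → ℝ} {a K : ℝ}
    (hf : ∀ y, f y ∈ Set.Icc a (a + K)) (x : Fin n → Y) (j : Fin n) (y : Y) :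
    |avg (Function.update x j y) f - avg x f| ≤ K / n := by
  have h : ∑ i, f (Function.update x j y i) - ∑ i, f (x i) = f y - f (x j) := by
    rw [← Finset.sum_sub_distrib, Finset.sum_eq_single j]
    · simp
    · intro i _ hi
      simp [Function.update_of_ne hi]
    · simp
  unfold avg
  rw [← mul_sub, h, abs_mul, abs_of_nonneg (by positivity : (0 : ℝ) ≤ 1 / n), one_div,
    inv_mul_eq_div]
  have h1 := hf y
  have h2 := hf (x j)
  gcongr
  exact abs_le.2 ⟨by linarith [h1.1, h2.2], by linarith [h1.2, h2.1]⟩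

lemma abs_supDev_update_sub_le [Nonempty ι] (q : Measure X) [IsProbabilityMeasure q] {n : ℕ}
    {f : ι → X → ℝ} {M a K : ℝ} (hM : 0 ≤ M) (hfM : ∀ i y, |f i y| ≤ M)
    (hf : ∀ i y, f i y ∈ Set.Icc a (a + K)) (x : Fin n → X) (j : Fin n) (y : X) :
    |supDev q f (Function.update x j y) - supDev q f x| ≤ K / n := by
  have hb : ∀ x : Fin n → X, BddAbove (Set.range fun i => avg x (f i) - ∫ y, f i y ∂q) :=
    fun x => bddAbove_range_of_abs_le fun i => abs_avg_sub_integral_le q hM (hfM i) x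
  have h := fun i => abs_le.1 (avg_update_sub_le (hf i) x j y)
  refine abs_sub_le_iff.2 ⟨?_, ?_⟩ <;> rw [sub_le_iff_le_add] <;> refine ciSup_le fun i => ?_
  · have := le_ciSup (hb x) i
    unfold supDev
    linarith [(h i).2]
  · have := le_ciSup (hb (Function.update x j y)) i
    unfold supDev
    linarith [(h i).1]

/-- With probability at least `1 - δ`, the largest deviation of the averages of a class with values
in an interval of length `K` exceeds twice its Rademacher complexity by less than
`K √(log (1 / δ) / (2 n))`. -/
lemma measureReal_supDev_ge_le [Nonempty ι] [Countable ι] (q : Measure X)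
    [IsProbabilityMeasure q] {n : ℕ} (hn : 0 < n) {f : ι → X → ℝ}
    (hfm : ∀ i, Measurable (f i)) {a K : ℝ} (hK : 0 < K)
    (hf : ∀ i y, f i y ∈ Set.Icc a (a + K)) {δ : ℝ} (hδ : 0 < δ) (hδ1 : δ ≤ 1) :
    (Measure.pi fun _ : Fin n => q).real
      {x | 2 * (∫ x : Fin n → X, empRademacher f x ∂(Measure.pi fun _ => q)) +
        K * √(Real.log (1 / δ) / (2 * n)) ≤ supDev q f x} ≤ δ := by
  have hn' : (0 : ℝ) < n := by exact_mod_cast hn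
  have hM : 0 ≤ |a| + K := by positivity
  have hfM : ∀ i y, |f i y| ≤ |a| + K := fun i y => by
    have h := hf i y
    exact abs_le.2 ⟨by linarith [h.1, neg_abs_le a], by linarith [h.2, le_abs_self a]⟩
  obtain ⟨k, hk⟩ : ∃ k : ℝ≥0, (k : ℝ) = K / n := ⟨⟨K / n, by positivity⟩, rfl⟩
  have hsub := hasSubgaussianMGF_of_boundedDifferences q k
    (measurable_supDev (n := n) q hfm) (abs_supDev_le q hM hfM)
    (fun x j y => (abs_supDev_update_sub_le q hM hfM hf x j y).trans_eq hk.symm)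
  have hlog : 0 ≤ Real.log (1 / δ) := Real.log_nonneg (by rw [le_div_iff₀ hδ]; linarith)
  have htail := hsub.measure_ge_le (ε := K * √(Real.log (1 / δ) / (2 * n))) (by positivity)
  have hexp : -(K * √(Real.log (1 / δ) / (2 * n))) ^ 2 /
      (2 * ((n * (k / 2) ^ 2 : ℝ≥0) : ℝ)) = Real.log δ := by
    rw [mul_pow, Real.sq_sqrt (by positivity)]
    push_cast
    rw [hk, one_div, Real.log_inv]
    field_simp
  rw [hexp, Real.exp_log hδ] at htail
  refine le_trans (measureReal_mono fun x hx => ?_) htail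
  have h := integral_supDev_le q hn hfm hM hfM
  simp only [Set.mem_ofPred_eq] at hx ⊢
  linarith

/-! ### Uniform laws for pointwise measurable classes -/

/-- Replacing a class by a subset in which it is sequentially dense for pointwise convergence does
not change its Rademacher complexity. -/
lemma rademacher_eq_integral_empRademacher {G G₀ : Set (X → ℝ)} {n : ℕ} {C : ℝ} (hC : 0 ≤ C)
    (q : Measure X) (hGC : ∀ g ∈ G, ∀ x, |g x| ≤ C) (h₀ : G₀ ⊆ G) (hne : G₀.Nonempty)
    (hlim : ∀ g ∈ G, ∃ u : ℕ → X → ℝ,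
      (∀ k, u k ∈ G₀) ∧ ∀ x, Tendsto (fun k => u k x) atTop (𝓝 (g x))) :
    rademacher n q G =
      ∫ x : Fin n → X, empRademacher (fun g : G₀ => (g : X → ℝ)) x ∂(Measure.pi fun _ => q) := by
  have : Nonempty G₀ := hne.to_subtype
  have : Nonempty G := (hne.mono h₀).to_subtype
  have hb : ∀ (g : G) (ξ : Fin n → Bool) (x : Fin n → X),
      |(1 / (n : ℝ)) * ∑ i, sgn (ξ i) * (g : X → ℝ) (x i)| ≤ C := fun g ξ x =>
    abs_mean_sgn_mul_le hC ξ fun j => hGC g g.2 (x j)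
  unfold rademacher empRademacher
  congr 1
  funext x
  congr 1
  refine Finset.sum_congr rfl fun ξ _ => le_antisymm (ciSup_le fun g => ?_) (ciSup_le fun g => ?_)
  · obtain ⟨u, hu, hug⟩ := hlim g g.2
    have ht : Tendsto (fun k => (1 / (n : ℝ)) * ∑ i, sgn (ξ i) * u k (x i)) atTop
        (𝓝 ((1 / (n : ℝ)) * ∑ i, sgn (ξ i) * (g : X → ℝ) (x i))) :=
      (tendsto_finsetSum _ fun i _ => (hug (x i)).const_mul _).const_mul _
    refine le_of_tendsto' ht fun k => ?_
    exact le_ciSup (f := fun g : G₀ => (1 / (n : ℝ)) * ∑ i, sgn (ξ i) * (g : X → ℝ) (x i))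
      (bddAbove_range_of_abs_le fun g => hb ⟨g, h₀ g.2⟩ ξ x) ⟨u k, hu k⟩
  · exact le_ciSup (f := fun g : G => (1 / (n : ℝ)) * ∑ i, sgn (ξ i) * (g : X → ℝ) (x i))
      (bddAbove_range_of_abs_le fun g => hb g ξ x) ⟨g, h₀ g.2⟩

/-- The one-sided uniform law for the class of the functions `F x (g x)`, `g ∈ G`. The countable
subclass makes the supremum measurable; dominated convergence carries the bound to all of `G`. -/
lemma exists_measure_le_avg_sub_integral_le (q : Measure X) [IsProbabilityMeasure q]
    {G : Set (X → ℝ)} (hG : PointwiseMeasurable G) (hne : G.Nonempty) {C : ℝ} (hC : 0 ≤ C)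
    (hGC : ∀ g ∈ G, ∀ x, |g x| ≤ C) {n : ℕ} (hn : 0 < n) {F : X → ℝ → ℝ}
    (hFm : ∀ g ∈ G, Measurable fun x => F x (g x)) {a K L : ℝ} (hK : 0 < K) (hL : 0 ≤ L)
    (hF : ∀ x t, |t| ≤ C → F x t ∈ Set.Icc a (a + K))
    (hFL : ∀ x s t, |s| ≤ C → |t| ≤ C → |F x s - F x t| ≤ L * |s - t|)
    {δ : ℝ} (hδ : 0 < δ) (hδ1 : δ ≤ 1) :
    ∃ B : Set (Fin n → X), MeasurableSet B ∧ (Measure.pi fun _ => q).real B ≤ δ ∧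
      ∀ x ∉ B, ∀ g ∈ G, avg x (fun y => F y (g y)) - ∫ y, F y (g y) ∂q ≤
        2 * L * rademacher n q G + K * √(Real.log (1 / δ) / (2 * n)) := by
  obtain ⟨hGm, G₀, h₀, hcount, hlim⟩ := hG
  have hne₀ : G₀.Nonempty := by
    obtain ⟨g, hg⟩ := hne
    obtain ⟨u, hu, -⟩ := hlim g hg
    exact ⟨u 0, hu 0⟩
  have : Nonempty G₀ := hne₀.to_subtype
  have : Countable G₀ := hcount.to_subtype
  set f : G₀ → X → ℝ := fun g y => F y ((g : X → ℝ) y) with hf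
  have hfm : ∀ g, Measurable (f g) := fun g => hFm g (h₀ g.2)
  have hfI : ∀ g y, f g y ∈ Set.Icc a (a + K) := fun g y => hF y _ (hGC g (h₀ g.2) y)
  set M := max (|a| + K) C with hM
  have hM0 : 0 ≤ M := le_max_of_le_right hC
  have hFM : ∀ x t, |t| ≤ C → |F x t| ≤ M := fun x t ht => by
    have h := hF x t ht
    exact le_max_of_le_left (abs_le.2
      ⟨by linarith [h.1, neg_abs_le a], by linarith [h.2, le_abs_self a]⟩)
  have hfM : ∀ g y, |f g y| ≤ M := fun g y => hFM y _ (hGC g (h₀ g.2) y)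
  have hrad : ∫ x : Fin n → X, empRademacher f x ∂(Measure.pi fun _ => q) ≤
      L * rademacher n q G := by
    rw [rademacher_eq_integral_empRademacher hC q hGC h₀ hne₀ hlim, ← integral_const_mul]
    have hgM : ∀ (g : G₀) y, |(g : X → ℝ) y| ≤ M := fun g y =>
      le_max_of_le_right (hGC g (h₀ g.2) y)
    exact integral_mono (integrable_empRademacher q hfm hM0 hfM)
      ((integrable_empRademacher q (f := fun g : G₀ => (g : X → ℝ))
        (fun g => hGm g (h₀ g.2)) hM0 hgM).const_mul L)
      (empRademacher_le_of_lipschitz hL hfM hgM fun i j y =>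
        hFL y _ _ (hGC i (h₀ i.2) y) (hGC j (h₀ j.2) y))
  refine ⟨_, measurableSet_le measurable_const (measurable_supDev (n := n) q hfm),
    measureReal_supDev_ge_le q hn hfm hK hfI hδ hδ1, fun x hx => ?_⟩
  simp only [Set.mem_ofPred_eq, not_le] at hx
  have hx₀ : ∀ g ∈ G₀, avg x (fun y => F y (g y)) - ∫ y, F y (g y) ∂q ≤
      2 * L * rademacher n q G + K * √(Real.log (1 / δ) / (2 * n)) := fun g hg => by
    have := le_ciSup (f := fun g : G₀ => avg x (f g) - ∫ y, f g y ∂q)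
      (bddAbove_range_of_abs_le fun g => abs_avg_sub_integral_le q hM0 (hfM g) x) ⟨g, hg⟩
    refine this.trans (hx.le.trans ?_)
    linarith
  intro g hg
  obtain ⟨u, hu, hug⟩ := hlim g hg
  have hFlim : ∀ y, Tendsto (fun k => F y (u k y)) atTop (𝓝 (F y (g y))) := fun y => by
    rw [tendsto_iff_dist_tendsto_zero]
    refine squeeze_zero (fun _ => dist_nonneg)
      (fun k => (hFL y _ _ (hGC _ (h₀ (hu k)) y) (hGC g hg y) :)) ?_
    have := (tendsto_iff_dist_tendsto_zero.1 (hug y)).const_mul L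
    simpa [Real.dist_eq] using this
  have havg : Tendsto (fun k => avg x (fun y => F y (u k y))) atTop
      (𝓝 (avg x fun y => F y (g y))) :=
    (tendsto_finsetSum _ fun i _ => hFlim (x i)).const_mul _
  have hint : Tendsto (fun k => ∫ y, F y (u k y) ∂q) atTop (𝓝 (∫ y, F y (g y) ∂q)) :=
    tendsto_integral_of_dominated_convergence (fun _ => M)
      (fun k => (hFm _ (h₀ (hu k))).aestronglyMeasurable) (integrable_const _)
      (fun k => ae_of_all _ fun y => hFM y _ (hGC _ (h₀ (hu k)) y)) (ae_of_all _ hFlim)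
  exact le_of_tendsto' (havg.sub hint) fun k => hx₀ _ (hu k)

/-- The two-sided uniform law for an i.i.d. sample. -/
lemma IsSample.exists_measure_le_abs_avg_sub_integral_le {Ω : Type*} [MeasurableSpace Ω]
    {μ : Measure Ω} [IsProbabilityMeasure μ] {q : Measure X} {n : ℕ} {x : Fin n → Ω → X}
    (hx : IsSample μ q x) (hn : 0 < n)
    {G : Set (X → ℝ)} (hG : PointwiseMeasurable G) (hne : G.Nonempty) {C : ℝ} (hC : 0 ≤ C)
    (hGC : ∀ g ∈ G, ∀ x, |g x| ≤ C) {F : X → ℝ → ℝ}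
    (hFm : ∀ g ∈ G, Measurable fun x => F x (g x)) {K L : ℝ} (hK : 0 < K) (hL : 0 ≤ L)
    (hF : ∀ x t, |t| ≤ C → F x t ∈ Set.Icc 0 K)
    (hFL : ∀ x s t, |s| ≤ C → |t| ≤ C → |F x s - F x t| ≤ L * |s - t|)
    {δ : ℝ} (hδ : 0 < δ) (hδ1 : δ ≤ 1) :
    ∃ B : Set Ω, MeasurableSet B ∧ μ.real B ≤ 2 * δ ∧
      ∀ ω ∉ B, ∀ g ∈ G,
        |avg (fun i => x i ω) (fun y => F y (g y)) - ∫ y, F y (g y) ∂q| ≤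
          2 * L * rademacher n q G + K * √(Real.log (1 / δ) / (2 * n)) := by
  have : IsProbabilityMeasure q := (hx.2 ⟨0, hn⟩).isProbabilityMeasure_iff.1 inferInstance
  have hxm : AEMeasurable (fun ω i => x i ω) μ := aemeasurable_pi_lambda _ fun i =>
    (hx.2 i).aemeasurable
  have hlaw : μ.map (fun ω i => x i ω) = Measure.pi fun _ => q := by
    rw [hx.1.map_fun_eq_pi_map fun i => (hx.2 i).aemeasurable]
    simp_rw [(hx.2 _).map_eq]
  obtain ⟨B₁, hB₁, hB₁δ, h₁⟩ := exists_measure_le_avg_sub_integral_le q hG hne hC hGC hn hFm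
    (a := 0) hK hL (by simpa using hF) hFL hδ hδ1
  obtain ⟨B₂, hB₂, hB₂δ, h₂⟩ := exists_measure_le_avg_sub_integral_le q hG hne hC hGC hn
    (F := fun x t => -F x t) (fun g hg => (hFm g hg).neg)
    (a := -K) hK hL (fun y t ht => ⟨by linarith [(hF y t ht).2], by linarith [(hF y t ht).1]⟩)
    (fun y s t hs ht => by rw [neg_sub_neg, abs_sub_comm]; exact hFL y s t hs ht) hδ hδ1
  refine ⟨toMeasurable μ ((fun ω i => x i ω) ⁻¹' (B₁ ∪ B₂)), measurableSet_toMeasurable _ _, ?_,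
    fun ω hω g hg => ?_⟩
  · rw [measureReal_def, measure_toMeasurable,
      ← Measure.map_apply_of_aemeasurable hxm (hB₁.union hB₂), hlaw, ← measureReal_def]
    linarith [measureReal_union_le (μ := Measure.pi fun _ : Fin n => q) B₁ B₂]
  · have hω' : (fun i => x i ω) ∉ B₁ ∪ B₂ := fun h => hω (subset_toMeasurable μ _ h)
    have e₁ := h₁ _ (fun h => hω' (Or.inl h)) g hg
    have e₂ := h₂ _ (fun h => hω' (Or.inr h)) g hg
    have hneg : avg (fun i => x i ω) (fun y => -F y (g y)) =
        -avg (fun i => x i ω) (fun y => F y (g y)) := by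
      simp [avg]
    rw [hneg, integral_neg] at e₂
    exact abs_le.2 ⟨by linarith, e₁⟩

/-! ### Decomposition of the risk -/

/-- Cauchy–Schwarz on a measurable set. -/
lemma setIntegral_le_sqrt_mul {ν : Measure X} [IsFiniteMeasure ν] {D : X → ℝ}
    (hD : Integrable D ν) (hD2 : Integrable (fun x => D x ^ 2) ν) (A : Set X) :
    ∫ x in A, D x ∂ν ≤ √(ν.real A * ∫ x, D x ^ 2 ∂ν) := by
  set I := ∫ x in A, D x ∂ν
  set S := ∫ x in A, D x ^ 2 ∂ν
  -- the quadratic `t ↦ ∫_A (D - t)²` is nonnegative, so its discriminant is not positive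
  have hquad : ∀ t : ℝ, 0 ≤ ν.real A * (t * t) + (-2 * I) * t + S := by
    intro t
    have h : ∫ x in A, (D x - t) ^ 2 ∂ν = S - 2 * t * I + t ^ 2 * ν.real A := by
      have e : ∀ x, (D x - t) ^ 2 = D x ^ 2 - 2 * t * D x + t ^ 2 := fun x => by ring
      simp_rw [e]
      have hlin : IntegrableOn (fun x => D x ^ 2 - 2 * t * D x) A ν :=
        hD2.integrableOn.sub (hD.integrableOn.const_mul _)
      rw [integral_add hlin (integrable_const _),
        integral_sub hD2.integrableOn (hD.integrableOn.const_mul _), integral_const_mul]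
      simp [I, S, mul_comm]
    have h0 : 0 ≤ ∫ x in A, (D x - t) ^ 2 ∂ν := integral_nonneg fun x => sq_nonneg _
    linarith
  have hd := discrim_le_zero hquad
  rw [discrim] at hd
  have hS' : S ≤ ∫ x, D x ^ 2 ∂ν :=
    setIntegral_le_integral hD2 (ae_of_all _ fun x => sq_nonneg _)
  refine Real.le_sqrt_of_sq_le ?_
  have := mul_le_mul_of_nonneg_left hS' (measureReal_nonneg (μ := ν) (s := A))
  linarith

section risk

variable {P : Measure (X × Bool × Bool)} [IsProbabilityMeasure P]

instance : IsProbabilityMeasure (marginal P) :=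
  Measure.isProbabilityMeasure_map measurable_fst.aemeasurable

/-- The defining identity of a conditional law. It also holds for a null set `s`, when both sides
vanish. -/
lemma measureReal_mul_integral_map_cond (s : Set (X × Bool × Bool)) {h : X → ℝ}
    (hh : Measurable h) :
    P.real s * ∫ x, h x ∂((ProbabilityTheory.cond P s).map Prod.fst) = ∫ z in s, h z.1 ∂P := by
  rw [integral_map measurable_fst.aemeasurable hh.aestronglyMeasurable, ProbabilityTheory.cond,
    integral_smul_measure, smul_eq_mul, ENNReal.toReal_inv, ← measureReal_def, ← mul_assoc]
  by_cases hs : P s = 0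
  · simp [measureReal_def, hs, setIntegral_measure_zero]
  · rw [mul_inv_cancel₀ ((measureReal_ne_zero_iff).2 hs), one_mul]

omit [IsProbabilityMeasure P] in
lemma measurableSet_label (p : Bool → Bool → Prop) :
    MeasurableSet {z : X × Bool × Bool | p z.2.1 z.2.2} :=
  measurable_snd (MeasurableSet.of_discrete (s := {b : Bool × Bool | p b.1 b.2}))

omit [IsProbabilityMeasure P] in
lemma map_restrict_le_marginal (s : Set (X × Bool × Bool)) :
    (P.restrict s).map Prod.fst ≤ marginal P :=
  Measure.map_mono Measure.restrict_le_self measurable_fst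

omit [IsProbabilityMeasure P] in
lemma measurable_sigma : Measurable (sigma P) := (Measure.measurable_rnDeriv _ _).ennreal_toReal

lemma sigma_mem_Icc : ∀ᵐ x ∂(marginal P), sigma P x ∈ Set.Icc (0 : ℝ) 1 := by
  filter_upwards [Measure.rnDeriv_le_one_of_le (map_restrict_le_marginal (P := P) _)] with x hx
  exact ⟨ENNReal.toReal_nonneg, ENNReal.toReal_le_of_le_ofReal zero_le_one (by simpa using hx)⟩

/-- The positive and the biased negative laws together make up the law of `x` on `s = +1`. -/
lemma posPrior_mul_add_bnPrior_mul (hP : PosLabeled P) {h : X → ℝ} (hh : Measurable h) {M : ℝ}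
    (hM : ∀ x, |h x| ≤ M) :
    posPrior P * (∫ x, h x ∂(posLaw P)) + bnPrior P * (∫ x, h x ∂(bnLaw P)) =
      ∫ x, sigma P x * h x ∂(marginal P) := by
  have hint : Integrable (fun z : X × Bool × Bool => h z.1) P :=
    integrable_of_abs_le (hh.comp measurable_fst) fun z => hM _
  have hσ : ∫ x, sigma P x * h x ∂(marginal P) =
      ∫ z in {z : X × Bool × Bool | z.2.2 = true}, h z.1 ∂P :=
    (integral_toReal_rnDeriv_mul (Measure.absolutelyContinuous_of_le
      (map_restrict_le_marginal _))).trans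
      (integral_map measurable_fst.aemeasurable hh.aestronglyMeasurable)
  rw [hσ, posPrior, bnPrior, posLaw, bnLaw, measureReal_mul_integral_map_cond _ hh,
    measureReal_mul_integral_map_cond _ hh,
    ← setIntegral_union ?_ (measurableSet_label fun y s => y = false ∧ s = true)
      hint.integrableOn hint.integrableOn]
  · refine setIntegral_congr_set ?_
    have hnull : ∀ᵐ z ∂P, ¬(z.2.1 = true ∧ z.2.2 = false) := by
      rw [ae_iff]
      simp only [not_not]
      exact hP
    filter_upwards [hnull] with z hz
    refine propext ?_
    change ((z.2.1 = true) ∨ (z.2.1 = false ∧ z.2.2 = true)) ↔ z.2.2 = true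
    revert hz
    cases z.2.1 <;> cases z.2.2 <;> simp
  · rw [Set.disjoint_left]
    rintro z hz ⟨hz', -⟩
    simp_all

/-- The risk splits into its parts on `y = +1`, on `y = -1, s = +1` and on `s = -1`. -/
lemma risk_eq (hP : PosLabeled P) {ℓ : ℝ → ℝ} {g : X → ℝ}
    (hm : Measurable fun x => ℓ (g x)) (hm' : Measurable fun x => ℓ (-g x)) {M : ℝ}
    (hM : ∀ x, |ℓ (g x)| ≤ M) (hM' : ∀ x, |ℓ (-g x)| ≤ M) :
    risk P ℓ g = posPrior P * (∫ x, ℓ (g x) ∂(posLaw P)) +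
      bnPrior P * (∫ x, ℓ (-g x) ∂(bnLaw P)) +
      ∫ x, (1 - sigma P x) * ℓ (-g x) ∂(marginal P) := by
  set A := {z : X × Bool × Bool | z.2.1 = true} with hA
  have hAm : MeasurableSet A := measurableSet_label fun y _ => y = true
  have hint' : Integrable (fun z : X × Bool × Bool => ℓ (-g z.1)) P :=
    integrable_of_abs_le (hm'.comp measurable_fst) fun z => hM' _
  have hint : Integrable (fun z : X × Bool × Bool => ℓ (g z.1)) P :=
    integrable_of_abs_le (hm.comp measurable_fst) fun z => hM _
  have hsplit : (fun z : X × Bool × Bool => ℓ (sgn z.2.1 * g z.1)) = fun z =>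
      A.indicator (fun z => ℓ (g z.1)) z + Aᶜ.indicator (fun z => ℓ (-g z.1)) z := by
    funext z
    by_cases hz : z.2.1 = true
    · simp [hA, hz, sgn]
    · simp [hA, hz, sgn]
  have hrisk : risk P ℓ g =
      ∫ z in A, ℓ (g z.1) ∂P + ∫ z in Aᶜ, ℓ (-g z.1) ∂P := by
    rw [risk, hsplit, integral_add (hint.indicator hAm) (hint'.indicator hAm.compl),
      integral_indicator hAm, integral_indicator hAm.compl]
  have hcompl := integral_add_compl hAm hint'
  have hmarg : ∫ x, ℓ (-g x) ∂(marginal P) = ∫ z, ℓ (-g z.1) ∂P :=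
    integral_map measurable_fst.aemeasurable hm'.aestronglyMeasurable
  have hpn := posPrior_mul_add_bnPrior_mul hP hm' hM'
  have hσint : Integrable (fun x => sigma P x * ℓ (-g x)) (marginal P) := by
    refine Integrable.of_bound (measurable_sigma.mul hm').aestronglyMeasurable M ?_
    filter_upwards [sigma_mem_Icc] with x hx
    rw [Real.norm_eq_abs, abs_mul, abs_of_nonneg hx.1]
    exact (mul_le_of_le_one_left (abs_nonneg _) hx.2).trans (hM' x)
  have hone : ∫ x, (1 - sigma P x) * ℓ (-g x) ∂(marginal P) =
      ∫ x, ℓ (-g x) ∂(marginal P) - ∫ x, sigma P x * ℓ (-g x) ∂(marginal P) := by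
    rw [← integral_sub (integrable_of_abs_le hm' hM') hσint]
    exact integral_congr_ae (ae_of_all _ fun x => by ring)
  have h1 : posPrior P * ∫ x, ℓ (g x) ∂(posLaw P) = ∫ z in A, ℓ (g z.1) ∂P :=
    measureReal_mul_integral_map_cond A hm
  have h2 : posPrior P * ∫ x, ℓ (-g x) ∂(posLaw P) = ∫ z in A, ℓ (-g z.1) ∂P :=
    measureReal_mul_integral_map_cond A hm'
  linarith

/-! ### The bias of the PUbN risk -/

/-- The weight `1_{σ̂(x) > η} (1 - σ̂(x)) / σ̂(x)` of a labeled point. -/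
def labWeight (σhat : X → ℝ) (η : ℝ) : X → ℝ :=
  Set.indicator {x | η < σhat x} fun x => (1 - σhat x) / σhat x

omit [MeasurableSpace X] in
lemma labTerm_eq (ℓ : ℝ → ℝ) (σhat : X → ℝ) (η : ℝ) (g : X → ℝ) (x : X) :
    labTerm ℓ σhat η g x = labWeight σhat η x * ℓ (-g x) := by
  by_cases hx : η < σhat x <;> simp [labTerm, labWeight, hx, mul_comm]

/-- The weight `1_{σ̂(x) ≤ η} (1 - σ̂(x))` of an unlabeled point. -/
def uWeight (σhat : X → ℝ) (η : ℝ) : X → ℝ :=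
  Set.indicator {x | σhat x ≤ η} fun x => 1 - σhat x

omit [MeasurableSpace X] in
lemma uTerm_eq (ℓ : ℝ → ℝ) (σhat : X → ℝ) (η : ℝ) (g : X → ℝ) (x : X) :
    uTerm ℓ σhat η g x = uWeight σhat η x * ℓ (-g x) := by
  by_cases hx : σhat x ≤ η <;> simp [uTerm, uWeight, hx, mul_comm]

variable {σhat : X → ℝ} {η : ℝ}

lemma measurable_labWeight (hσm : Measurable σhat) : Measurable (labWeight σhat η) :=
  ((measurable_const.sub hσm).div hσm).indicator (measurableSet_lt measurable_const hσm)

lemma measurable_uWeight (hσm : Measurable σhat) : Measurable (uWeight σhat η) :=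
  (measurable_const.sub hσm).indicator (measurableSet_le hσm measurable_const)

omit [MeasurableSpace X] in
lemma labWeight_nonneg (hσ : ∀ x, σhat x ∈ Set.Icc (0 : ℝ) 1) (x : X) :
    0 ≤ labWeight σhat η x :=
  Set.indicator_nonneg (fun x _ => div_nonneg (by linarith [(hσ x).2]) (hσ x).1) x

omit [MeasurableSpace X] in
lemma one_add_labWeight_le (hη : η ∈ Set.Ioc (0 : ℝ) 1) (x : X) :
    1 + labWeight σhat η x ≤ 1 / η := by
  by_cases hx : η < σhat x
  · have h0 : 0 < σhat x := hη.1.trans hx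
    have e : 1 + labWeight σhat η x = 1 / σhat x := by
      simp only [labWeight, Set.mem_ofPred_eq, hx, Set.indicator_of_mem]
      field_simp
      ring
    rw [e]
    exact one_div_le_one_div_of_le hη.1 hx.le
  · have e : labWeight σhat η x = 0 := by simp [labWeight, hx]
    rw [e, add_zero]
    exact (one_le_div hη.1).2 hη.2

omit [MeasurableSpace X] in
lemma uWeight_mem_Icc (hσ : ∀ x, σhat x ∈ Set.Icc (0 : ℝ) 1) (x : X) :
    uWeight σhat η x ∈ Set.Icc (0 : ℝ) 1 := by
  have h := hσ x
  by_cases hx : σhat x ≤ η <;> simp [uWeight, hx, h.1, h.2]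

/-- The population counterpart of the empirical risk approximates the risk. With
`D = |σ̂ - σ|`, the integrands on `s = -1` differ by at most `Cℓ D` where `σ̂ ≤ η`, and by at most
`Cℓ D / η` elsewhere, so that Cauchy–Schwarz applies on each of the two sets. -/
lemma abs_risk_sub_le (hP : PosLabeled P) {ℓ : ℝ → ℝ} {g : X → ℝ} {C : ℝ} (hC : 0 ≤ C)
    (hm : Measurable fun x => ℓ (g x)) (hm' : Measurable fun x => ℓ (-g x))
    (hM : ∀ x, ℓ (g x) ∈ Set.Icc 0 C) (hM' : ∀ x, ℓ (-g x) ∈ Set.Icc 0 C)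
    (hσm : Measurable σhat) (hσ : ∀ x, σhat x ∈ Set.Icc (0 : ℝ) 1) (hη : η ∈ Set.Ioc (0 : ℝ) 1) :
    |risk P ℓ g - (posPrior P * (∫ x, (ℓ (g x) + labWeight σhat η x * ℓ (-g x)) ∂(posLaw P)) +
      bnPrior P * (∫ x, (1 + labWeight σhat η x) * ℓ (-g x) ∂(bnLaw P)) +
      ∫ x, uWeight σhat η x * ℓ (-g x) ∂(marginal P))| ≤
      C * √((marginal P).real {x | σhat x ≤ η} *
          ∫ x, |σhat x - sigma P x| ^ 2 ∂(marginal P)) +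
        C / η * √((1 - (marginal P).real {x | σhat x ≤ η}) *
          ∫ x, |σhat x - sigma P x| ^ 2 ∂(marginal P)) := by
  set D : X → ℝ := fun x => |σhat x - sigma P x| with hD
  set A := {x | σhat x ≤ η} with hA
  have hAm : MeasurableSet A := measurableSet_le hσm measurable_const
  have hDm : Measurable D := (hσm.sub measurable_sigma).abs
  have hD1 : ∀ᵐ x ∂(marginal P), D x ≤ 1 := by
    filter_upwards [sigma_mem_Icc] with x hx
    exact abs_le.2 ⟨by linarith [(hσ x).1, hx.2], by linarith [(hσ x).2, hx.1]⟩
  have hDint : Integrable D (marginal P) := by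
    refine Integrable.of_bound hDm.aestronglyMeasurable 1 ?_
    filter_upwards [hD1] with x hx
    simpa [hD] using hx
  have hD2int : Integrable (fun x => D x ^ 2) (marginal P) := by
    refine Integrable.of_bound (hDm.pow_const 2).aestronglyMeasurable 1 ?_
    filter_upwards [hD1] with x hx
    rw [Real.norm_eq_abs, abs_of_nonneg (sq_nonneg _)]
    exact pow_le_one₀ (abs_nonneg _) hx
  have hη0 := hη.1
  have hW : ∀ x, labWeight σhat η x ∈ Set.Icc 0 (1 / η) := fun x =>
    ⟨labWeight_nonneg hσ x, by linarith [one_add_labWeight_le (σhat := σhat) hη x]⟩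
  have hU := uWeight_mem_Icc (η := η) hσ
  have habs : ∀ {a : ℝ}, a ∈ Set.Icc 0 C → |a| ≤ C := fun {a} h => by
    rw [abs_of_nonneg h.1]; exact h.2
  have hw : Measurable fun x => labWeight σhat η x * ℓ (-g x) := (measurable_labWeight hσm).mul hm'
  have hwM : ∀ x, |labWeight σhat η x * ℓ (-g x)| ≤ 1 / η * C := fun x => by
    rw [abs_mul, abs_of_nonneg (hW x).1]
    exact mul_le_mul (hW x).2 (habs (hM' x)) (abs_nonneg _) (by positivity)
  have hu : Measurable fun x => uWeight σhat η x * ℓ (-g x) := (measurable_uWeight hσm).mul hm'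
  have huM : ∀ x, |uWeight σhat η x * ℓ (-g x)| ≤ 1 * C := fun x => by
    rw [abs_mul, abs_of_nonneg (hU x).1]
    exact mul_le_mul (hU x).2 (habs (hM' x)) (abs_nonneg _) zero_le_one
  have hfin : ∀ s, IsFiniteMeasure ((ProbabilityTheory.cond P s).map Prod.fst : Measure X) := by
    intro s
    by_cases hs : P s = 0
    · simp only [ProbabilityTheory.cond, Measure.restrict_eq_zero.2 hs, smul_zero,
        Measure.map_zero]
      infer_instance
    · have := ProbabilityTheory.cond_isProbabilityMeasure hs
      infer_instance
  have : IsFiniteMeasure (posLaw P) := hfin _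
  have : IsFiniteMeasure (bnLaw P) := hfin _
  have hpos : ∫ x, (ℓ (g x) + labWeight σhat η x * ℓ (-g x)) ∂(posLaw P) =
      ∫ x, ℓ (g x) ∂(posLaw P) + ∫ x, labWeight σhat η x * ℓ (-g x) ∂(posLaw P) :=
    integral_add (integrable_of_abs_le hm fun x => habs (hM x)) (integrable_of_abs_le hw hwM)
  have hbn : ∫ x, (1 + labWeight σhat η x) * ℓ (-g x) ∂(bnLaw P) =
      ∫ x, ℓ (-g x) ∂(bnLaw P) + ∫ x, labWeight σhat η x * ℓ (-g x) ∂(bnLaw P) := by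
    rw [← integral_add (integrable_of_abs_le hm' fun x => habs (hM' x))
      (integrable_of_abs_le hw hwM)]
    simp_rw [add_mul, one_mul]
  have hpn := posPrior_mul_add_bnPrior_mul hP hw hwM
  have hσb : ∀ {h : X → ℝ} {M : ℝ}, Measurable h → (∀ x, |h x| ≤ M) →
      Integrable (fun x => sigma P x * h x) (marginal P) := by
    intro h M hh hhM
    refine Integrable.of_bound (measurable_sigma.mul hh).aestronglyMeasurable M ?_
    filter_upwards [sigma_mem_Icc] with x hx
    rw [Real.norm_eq_abs, abs_mul, abs_of_nonneg hx.1]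
    exact (mul_le_of_le_one_left (abs_nonneg _) hx.2).trans (hhM x)
  have hint1 : Integrable (fun x => (1 - sigma P x) * ℓ (-g x)) (marginal P) := by
    simp_rw [sub_mul, one_mul]
    exact (integrable_of_abs_le hm' fun x => habs (hM' x)).sub (hσb hm' fun x => habs (hM' x))
  have hint2 : Integrable (fun x => sigma P x * (labWeight σhat η x * ℓ (-g x)) +
      uWeight σhat η x * ℓ (-g x)) (marginal P) :=
    (hσb hw hwM).add (integrable_of_abs_le hu huM)
  have hdiff : risk P ℓ g -
      (posPrior P * (∫ x, (ℓ (g x) + labWeight σhat η x * ℓ (-g x)) ∂(posLaw P)) +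
      bnPrior P * (∫ x, (1 + labWeight σhat η x) * ℓ (-g x) ∂(bnLaw P)) +
      ∫ x, uWeight σhat η x * ℓ (-g x) ∂(marginal P)) =
      ∫ x, ((1 - sigma P x) * ℓ (-g x) - (sigma P x * (labWeight σhat η x * ℓ (-g x)) +
        uWeight σhat η x * ℓ (-g x))) ∂(marginal P) := by
    rw [integral_sub hint1 hint2,
      integral_add (hσb hw hwM) (integrable_of_abs_le hu huM), ← hpn,
      risk_eq hP hm hm' (fun x => habs (hM x)) (fun x => habs (hM' x)), hpos, hbn]
    ring
  rw [hdiff]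
  have hpt : ∀ x, |(1 - sigma P x) * ℓ (-g x) - (sigma P x * (labWeight σhat η x * ℓ (-g x)) +
      uWeight σhat η x * ℓ (-g x))| ≤
      A.indicator (fun x => C * D x) x + Aᶜ.indicator (fun x => C / η * D x) x := by
    intro x
    by_cases hx : σhat x ≤ η
    · have e : (1 - sigma P x) * ℓ (-g x) - (sigma P x * (labWeight σhat η x * ℓ (-g x)) +
          uWeight σhat η x * ℓ (-g x)) = ℓ (-g x) * (σhat x - sigma P x) := by
        simp [labWeight, uWeight, hx]
        ring
      rw [e, abs_mul]
      simpa [hA, hx] using mul_le_mul_of_nonneg_right (habs (hM' x)) (abs_nonneg _)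
    · have h0 : 0 < σhat x := hη.1.trans (not_le.1 hx)
      have e : (1 - sigma P x) * ℓ (-g x) - (sigma P x * (labWeight σhat η x * ℓ (-g x)) +
          uWeight σhat η x * ℓ (-g x)) = ℓ (-g x) / σhat x * (σhat x - sigma P x) := by
        simp only [labWeight, uWeight, Set.indicator, Set.mem_ofPred_eq, hx, not_le.1 hx, if_true,
          if_false]
        field_simp
        ring
      rw [e, abs_mul, abs_div, abs_of_pos h0]
      have := div_le_div₀ hC (habs (hM' x)) hη.1 (not_le.1 hx).le
      simpa [hA, hx] using mul_le_mul_of_nonneg_right this (abs_nonneg (σhat x - sigma P x))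
  have hbound : |∫ x, ((1 - sigma P x) * ℓ (-g x) -
      (sigma P x * (labWeight σhat η x * ℓ (-g x)) + uWeight σhat η x * ℓ (-g x)))
        ∂(marginal P)| ≤ C * (∫ x in A, D x ∂(marginal P)) +
          C / η * ∫ x in Aᶜ, D x ∂(marginal P) := by
    rw [← integral_const_mul, ← integral_const_mul, ← integral_indicator hAm,
      ← integral_indicator hAm.compl, ← integral_add ((hDint.const_mul _).indicator hAm)
        ((hDint.const_mul _).indicator hAm.compl)]
    refine abs_integral_le_integral_abs.trans (integral_mono ?_ (((hDint.const_mul _).indicator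
      hAm).add ((hDint.const_mul _).indicator hAm.compl)) hpt)
    exact (hint1.sub hint2).abs
  refine hbound.trans (add_le_add ?_ ?_)
  · exact mul_le_mul_of_nonneg_left (setIntegral_le_sqrt_mul hDint hD2int A) hC
  · rw [← probReal_compl_eq_one_sub hAm]
    exact mul_le_mul_of_nonneg_left (setIntegral_le_sqrt_mul hDint hD2int Aᶜ) (by positivity)

end risk

/-! ### The estimation error bound -/

/-- Only the values of the loss on `[-C, C]` matter, where it is continuous. -/
lemma measurable_comp_of_lipschitzOnWith {ℓ : ℝ → ℝ} {L : ℝ≥0} {C : ℝ}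
    (hℓ : LipschitzOnWith L ℓ (Set.Icc (-C) C)) {g : X → ℝ} (hg : Measurable g)
    (hgC : ∀ x, |g x| ≤ C) : Measurable fun x => ℓ (g x) := by
  obtain ⟨ℓ', hℓ', heq⟩ := hℓ.extend_real
  have : (fun x => ℓ (g x)) = fun x => ℓ' (g x) := funext fun x => heq (abs_le.1 (hgC x))
  rw [this]
  exact hℓ'.continuous.measurable.comp hg

omit [MeasurableSpace X] in
/-- The empirical risk as one average per sample. -/
lemma empRisk_eq (π ρ : ℝ) (ℓ : ℝ → ℝ) (σhat : X → ℝ) (η : ℝ) {nP nbN nU : ℕ}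
    (xP : Fin nP → X) (xbN : Fin nbN → X) (xU : Fin nU → X) (g : X → ℝ) :
    empRisk π ρ ℓ σhat η xP xbN xU g =
      π * avg xP (fun x => ℓ (g x) + labWeight σhat η x * ℓ (-g x)) +
      ρ * avg xbN (fun x => (1 + labWeight σhat η x) * ℓ (-g x)) +
      avg xU (fun x => uWeight σhat η x * ℓ (-g x)) := by
  simp only [empRisk, avg, labTerm_eq, uTerm_eq, add_mul, one_mul, Finset.sum_add_distrib]
  ring

/-- The excess risk of an empirical risk minimizer over any other function (primed) is controlled by
the bounds `a`, `b`, `c` for the deviations of the three averages and `B` for the bias. Here `R` is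
the risk, `E` the empirical risk, and `mP`, `mN`, `mU` are the means of the averages `vP`, `vN`,
`vU` over the positive, biased negative and unlabeled samples. -/
lemma excessRisk_le {π ρ B a b c : ℝ} (hπ : 0 ≤ π) (hρ : 0 ≤ ρ)
    {R R' E E' vP vP' vN vN' vU vU' mP mP' mN mN' mU mU' : ℝ}
    (hmin : E ≤ E') (hE : E = π * vP + ρ * vN + vU) (hE' : E' = π * vP' + ρ * vN' + vU')
    (hB : |R - (π * mP + ρ * mN + mU)| ≤ B) (hB' : |R' - (π * mP' + ρ * mN' + mU')| ≤ B)
    (hP : |vP - mP| ≤ a) (hP' : |vP' - mP'| ≤ a) (hN : |vN - mN| ≤ b) (hN' : |vN' - mN'| ≤ b)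
    (hU : |vU - mU| ≤ c) (hU' : |vU' - mU'| ≤ c) :
    R - R' ≤ 2 * (π * a) + 2 * (ρ * b) + 2 * c + 2 * B := by
  have h1 := mul_le_mul_of_nonneg_left (abs_le.1 hP).1 hπ
  have h2 := mul_le_mul_of_nonneg_left (abs_le.1 hP').2 hπ
  have h3 := mul_le_mul_of_nonneg_left (abs_le.1 hN).1 hρ
  have h4 := mul_le_mul_of_nonneg_left (abs_le.1 hN').2 hρ
  have h5 := (abs_le.1 hU).1
  have h6 := (abs_le.1 hU').2
  have h7 := (abs_le.1 hB).2
  have h8 := (abs_le.1 hB').1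
  linarith

end PUbN

end

theorem theorem2
    {d : ℕ} (P : Measure (EuclideanSpace ℝ (Fin d) × Bool × Bool)) [IsProbabilityMeasure P]
    (hP : PUbN.PosLabeled P)
    -- the function class and the loss
    (G : Set (EuclideanSpace ℝ (Fin d) → ℝ)) (hG : PUbN.PointwiseMeasurable G)
    (ℓ : ℝ → ℝ) (hℓ : ∀ z, 0 ≤ ℓ z)
    (Cg Cℓ : ℝ) (Lℓ : ℝ≥0) (hCg : 0 < Cg) (hCℓ : 0 < Cℓ)
    (hG_bdd : ∀ g ∈ G, ∀ x, |g x| ≤ Cg)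
    (hℓ_bdd : ∀ z, |z| ≤ Cg → ℓ z ≤ Cℓ)
    (hℓ_lip : LipschitzOnWith Lℓ ℓ (Set.Icc (-Cg) Cg))
    -- the fixed estimate of `σ` and the threshold
    (σhat : EuclideanSpace ℝ (Fin d) → ℝ) (hσ_meas : Measurable σhat)
    (hσ : ∀ x, σhat x ∈ Set.Icc (0 : ℝ) 1)
    (η : ℝ) (hη : η ∈ Set.Ioc (0 : ℝ) 1)
    -- the three samples
    {Ω : Type*} [MeasurableSpace Ω] (μ : Measure Ω) [IsProbabilityMeasure μ]
    (nP nbN nU : ℕ) (hnP : 0 < nP) (hnbN : 0 < nbN) (hnU : 0 < nU)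
    (xP : Fin nP → Ω → EuclideanSpace ℝ (Fin d))
    (xbN : Fin nbN → Ω → EuclideanSpace ℝ (Fin d))
    (xU : Fin nU → Ω → EuclideanSpace ℝ (Fin d))
    (hxP : PUbN.IsSample μ (PUbN.posLaw P) xP)
    (hxbN : PUbN.IsSample μ (PUbN.bnLaw P) xbN)
    (hxU : PUbN.IsSample μ (PUbN.marginal P) xU)
    -- the true risk minimizer and the PUbN empirical risk minimizer
    (gstar : EuclideanSpace ℝ (Fin d) → ℝ) (hgstar_mem : gstar ∈ G)
    (hgstar : IsMinOn (PUbN.risk P ℓ) G gstar)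
    (ghat : Ω → EuclideanSpace ℝ (Fin d) → ℝ)
    (hghat : ∀ᵐ ω ∂μ, ghat ω ∈ G ∧
      IsMinOn (PUbN.empRisk (PUbN.posPrior P) (PUbN.bnPrior P) ℓ σhat η
        (fun i => xP i ω) (fun i => xbN i ω) (fun i => xU i ω)) G (ghat ω))
    (ζ ε : ℝ) (hζ : ζ = (PUbN.marginal P).real {x | σhat x ≤ η})
    (hε : ε = ∫ x, |σhat x - PUbN.sigma P x| ^ 2 ∂(PUbN.marginal P))
    (δ : ℝ) (hδ : 0 < δ) :
    ∃ E : Set Ω, MeasurableSet E ∧ 1 - δ ≤ μ.real E ∧ ∀ ω ∈ E,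
      PUbN.risk P ℓ (ghat ω) - PUbN.risk P ℓ gstar ≤
        4 * Lℓ * PUbN.rademacher nU (PUbN.marginal P) G
        + 4 * PUbN.posPrior P * Lℓ / η * PUbN.rademacher nP (PUbN.posLaw P) G
        + 4 * PUbN.bnPrior P * Lℓ / η * PUbN.rademacher nbN (PUbN.bnLaw P) G
        + 2 * Cℓ * √(Real.log (6 / δ) / (2 * nU))
        + 2 * PUbN.posPrior P * Cℓ / η * √(Real.log (6 / δ) / (2 * nP))
        + 2 * PUbN.bnPrior P * Cℓ / η * √(Real.log (6 / δ) / (2 * nbN))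
        + 2 * Cℓ * √(ζ * ε)
        + 2 * Cℓ / η * √((1 - ζ) * ε) := by
  -- for `δ ≥ 1` the empty event will do, and otherwise `δ / 6 ≤ 1`
  rcases le_or_gt 1 δ with hδ1 | hδ1
  · exact ⟨∅, MeasurableSet.empty, by simpa using hδ1, fun ω hω => hω.elim⟩
  subst hζ hε
  have hη0 := hη.1
  have hneg : ∀ {t : ℝ}, |t| ≤ Cg → |-t| ≤ Cg := fun {t} h => by rwa [abs_neg]
  have hℓI : ∀ t, |t| ≤ Cg → ℓ t ∈ Set.Icc 0 Cℓ := fun t ht => ⟨hℓ t, hℓ_bdd t ht⟩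
  have hlip : ∀ s t : ℝ, |s| ≤ Cg → |t| ≤ Cg → |ℓ s - ℓ t| ≤ Lℓ * |s - t| := fun s t hs ht => by
    simpa [Real.dist_eq] using hℓ_lip.dist_le_mul s (abs_le.1 hs) t (abs_le.1 ht)
  have hlip' : ∀ s t : ℝ, |s| ≤ Cg → |t| ≤ Cg → |ℓ (-s) - ℓ (-t)| ≤ Lℓ * |s - t| :=
    fun s t hs ht => by
      have := hlip (-s) (-t) (hneg hs) (hneg ht)
      rwa [neg_sub_neg, abs_sub_comm t s] at this
  have hm : ∀ g ∈ G, Measurable fun x => ℓ (g x) := fun g hg =>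
    PUbN.measurable_comp_of_lipschitzOnWith hℓ_lip (hG.1 g hg) (hG_bdd g hg)
  have hm' : ∀ g ∈ G, Measurable fun x => ℓ (-g x) := fun g hg =>
    PUbN.measurable_comp_of_lipschitzOnWith hℓ_lip (hG.1 g hg).neg fun x => hneg (hG_bdd g hg x)
  have hw0 := PUbN.labWeight_nonneg (η := η) hσ
  have hw1 := PUbN.one_add_labWeight_le (σhat := σhat) hη
  have hwm := PUbN.measurable_labWeight (η := η) hσ_meas
  have hum := PUbN.measurable_uWeight (η := η) hσ_meas
  have hu := PUbN.uWeight_mem_Icc (η := η) hσ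
  have hne : G.Nonempty := ⟨gstar, hgstar_mem⟩
  have hδ6 : 0 < δ / 6 := by positivity
  have hδ6' : δ / 6 ≤ 1 := by linarith
  have hlog : 1 / (δ / 6) = 6 / δ := by field_simp
  obtain ⟨BP, hBP, hBPδ, hdevP⟩ := hxP.exists_measure_le_abs_avg_sub_integral_le hnP hG hne
    hCg.le hG_bdd (F := fun x t => ℓ t + PUbN.labWeight σhat η x * ℓ (-t))
    (fun g hg => (hm g hg).add (hwm.mul (hm' g hg))) (K := Cℓ / η) (L := Lℓ / η)
    (by positivity) (by positivity)
    (fun x t ht => by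
      have h1 := hℓI t ht
      have h2 := hℓI (-t) (hneg ht)
      refine ⟨add_nonneg h1.1 (mul_nonneg (hw0 x) h2.1), ?_⟩
      calc ℓ t + PUbN.labWeight σhat η x * ℓ (-t) ≤ Cℓ + PUbN.labWeight σhat η x * Cℓ :=
            add_le_add h1.2 (mul_le_mul_of_nonneg_left h2.2 (hw0 x))
        _ = (1 + PUbN.labWeight σhat η x) * Cℓ := by ring
        _ ≤ 1 / η * Cℓ := mul_le_mul_of_nonneg_right (hw1 x) hCℓ.le
        _ = Cℓ / η := by ring)
    (fun x s t hs ht => by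
      calc |ℓ s + PUbN.labWeight σhat η x * ℓ (-s) - (ℓ t + PUbN.labWeight σhat η x * ℓ (-t))|
          = |(ℓ s - ℓ t) + PUbN.labWeight σhat η x * (ℓ (-s) - ℓ (-t))| := by congr 1; ring
        _ ≤ |ℓ s - ℓ t| + PUbN.labWeight σhat η x * |ℓ (-s) - ℓ (-t)| := by
            refine (abs_add_le _ _).trans_eq ?_
            rw [abs_mul, abs_of_nonneg (hw0 x)]
        _ ≤ Lℓ * |s - t| + PUbN.labWeight σhat η x * (Lℓ * |s - t|) :=
            add_le_add (hlip s t hs ht) (mul_le_mul_of_nonneg_left (hlip' s t hs ht) (hw0 x))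
        _ = (1 + PUbN.labWeight σhat η x) * (Lℓ * |s - t|) := by ring
        _ ≤ 1 / η * (Lℓ * |s - t|) := mul_le_mul_of_nonneg_right (hw1 x) (by positivity)
        _ = Lℓ / η * |s - t| := by ring)
    hδ6 hδ6'
  obtain ⟨BN, hBN, hBNδ, hdevN⟩ := hxbN.exists_measure_le_abs_avg_sub_integral_le hnbN hG hne
    hCg.le hG_bdd (F := fun x t => (1 + PUbN.labWeight σhat η x) * ℓ (-t))
    (fun g hg => (measurable_const.add hwm).mul (hm' g hg)) (K := Cℓ / η) (L := Lℓ / η)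
    (by positivity) (by positivity)
    (fun x t ht => by
      have h2 := hℓI (-t) (hneg ht)
      refine ⟨mul_nonneg (by linarith [hw0 x]) h2.1, ?_⟩
      calc (1 + PUbN.labWeight σhat η x) * ℓ (-t) ≤ 1 / η * Cℓ :=
            mul_le_mul (hw1 x) h2.2 h2.1 (by positivity)
        _ = Cℓ / η := by ring)
    (fun x s t hs ht => by
      rw [← mul_sub, abs_mul, abs_of_nonneg (by linarith [hw0 x])]
      calc (1 + PUbN.labWeight σhat η x) * |ℓ (-s) - ℓ (-t)| ≤ 1 / η * (Lℓ * |s - t|) :=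
            mul_le_mul (hw1 x) (hlip' s t hs ht) (abs_nonneg _) (by positivity)
        _ = Lℓ / η * |s - t| := by ring)
    hδ6 hδ6'
  obtain ⟨BU, hBU, hBUδ, hdevU⟩ := hxU.exists_measure_le_abs_avg_sub_integral_le hnU hG hne
    hCg.le hG_bdd (F := fun x t => PUbN.uWeight σhat η x * ℓ (-t))
    (fun g hg => hum.mul (hm' g hg)) (K := Cℓ) (L := Lℓ) hCℓ Lℓ.2
    (fun x t ht => by
      have h2 := hℓI (-t) (hneg ht)
      exact ⟨mul_nonneg (hu x).1 h2.1, (mul_le_of_le_one_left h2.1 (hu x).2).trans h2.2⟩)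
    (fun x s t hs ht => by
      rw [← mul_sub, abs_mul, abs_of_nonneg (hu x).1]
      exact (mul_le_of_le_one_left (abs_nonneg _) (hu x).2).trans (hlip' s t hs ht))
    hδ6 hδ6'
  rw [hlog] at hdevP hdevN hdevU
  -- the exceptional null set of `ghat` need not be measurable
  obtain ⟨N, hN, hNm, hN0⟩ := exists_measurable_superset_of_null (ae_iff.1 hghat)
  have hNδ : μ.real N = 0 := by rw [measureReal_def, hN0, ENNReal.toReal_zero]
  refine ⟨(BP ∪ BN ∪ BU ∪ N)ᶜ, (((hBP.union hBN).union hBU).union hNm).compl, ?_,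
    fun ω hω => ?_⟩
  · rw [probReal_compl_eq_one_sub (((hBP.union hBN).union hBU).union hNm)]
    linarith [measureReal_union_le (μ := μ) (BP ∪ BN ∪ BU) N,
      measureReal_union_le (μ := μ) (BP ∪ BN) BU, measureReal_union_le (μ := μ) BP BN]
  simp only [Set.mem_compl_iff, Set.mem_union, not_or] at hω
  obtain ⟨⟨⟨hωP, hωN⟩, hωU⟩, hωh⟩ := hω
  obtain ⟨hmem, hmin⟩ := not_not.1 fun h => hωh (hN h)
  have hbias : ∀ g ∈ G, _ := fun g hg => PUbN.abs_risk_sub_le hP hCℓ.le (hm g hg) (hm' g hg)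
    (fun x => hℓI _ (hG_bdd g hg x)) (fun x => hℓI _ (hneg (hG_bdd g hg x))) hσ_meas hσ hη
  have key := PUbN.excessRisk_le (π := PUbN.posPrior P) (ρ := PUbN.bnPrior P)
    measureReal_nonneg measureReal_nonneg (isMinOn_iff.1 hmin gstar hgstar_mem)
    (PUbN.empRisk_eq ..) (PUbN.empRisk_eq ..) (hbias _ hmem) (hbias _ hgstar_mem)
    (hdevP ω hωP _ hmem) (hdevP ω hωP _ hgstar_mem) (hdevN ω hωN _ hmem)
    (hdevN ω hωN _ hgstar_mem) (hdevU ω hωU _ hmem) (hdevU ω hωU _ hgstar_mem)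
  refine key.trans (le_of_eq ?_)
  ring
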